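/- Let $n\ge 2$, let $\mathbb{T}^n=(\mathbb{R}/2\pi\mathbb{Z})^n$, let $1\le r\le\infty$ and $s\in\mathbb{R}$, and assume $s>0$ if $r>2$, and $s>n\left(\frac2r-1\right)$ if $1\le r\le 2$. Fix a smooth, nonnegative, radial function $\chi:\mathbb{R}^n\to\mathbb{R}$ with $\chi(\xi)=1$ for $|\xi|\le\frac12$ and $\chi(\xi)=0$ for $|\xi|\ge1$; put $\varphi(\xi)=\chi(\xi/2)-\chi(\xi)$, $\varphi_{-1}=\chi$ and $\varphi_q(\xi)=\varphi(2^{-q}\xi)$ for $q\ge0$. For a vector field $u$ on $\mathbb{T}^n$ with Fourier coefficients $\hat u(k)$ let $$u_q(x)=\sum_{k\in\mathbb{Z}^n}\hat u(k)\,\varphi_q(k)\,e^{ik\cdot x}\quad(q\ge-1),\qquad \|u\|_{B^s_{r,\infty}}=\sup_{q\ge-1}2^{qs}\|u_q\|_{L^r(\mathbb{T}^n)}\in[0,\infty].$$ Let $\vec e_1,\vec e_2$ be the first two standard basis vectors of $\mathbb{R}^n$ and let $$u_0(x)=\vec e_1\cos(x_2)+\vec e_2\sum_{q=0}^\infty 2^{-qs}\cos(2^q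 x_1),\qquad x\in\mathbb{T}^n.$$ For $T>0$, a weak solution on $[0,T)$ of the Euler equation $u_t+(u\cdot\nabla)u=-\nabla p$, $\operatorname{div}u=0$, on $\mathbb{T}^n$ is a divergence-free, $L^2(\mathbb{T}^n;\mathbb{R}^n)$-valued field $u$, weakly continuous in time on $[0,T)$, which satisfies the equation in the sense of distributions, that is, $$\int_0^T\!\!\int_{\mathbb{T}^n}\bigl(u\cdot\partial_t\phi+(u\otimes u):\nabla\phi\bigr)\,dx\,dt=0$$ for every smooth divergence-free vector field $\phi$ with compact support in $(0,T)\times\mathbb{T}^n$. Then there is $\delta>0$, depending only on $n,r,s$ (and on the fixed function $\chi$), such that for every $T>0$ and every weak solution $u$ on $[0,T)$ with $u(0)=u_0$, $$\limsup_{t\to0^+}\|u(t)-u_0\|_{B^s_{r,\infty}}\ge\delta .$$ -/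

import Mathlib

open MeasureTheory Filter Topology Real
open scoped ENNReal ContDiff

noncomputable section

namespace PeriodicEuler

instance factTwoPiPos : Fact (0 < 2 * π) := ⟨Real.two_pi_pos⟩

/-- The Euclidean space `ℝⁿ`. -/
abbrev Vec (n : ℕ) : Type := EuclideanSpace ℝ (Fin n)

/-- The torus `𝕋ⁿ = (ℝ / 2πℤ)ⁿ`, which carries the (product) Lebesgue measure. -/
abbrev Torus (n : ℕ) : Type := Fin n → AddCircle (2 * π)

/-- The point of the torus represented by `x ∈ ℝⁿ`. -/
def toTorus {n : ℕ} (x : Fin n → ℝ) : Torus n := fun j => (x j : AddCircle (2 * π))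

/-- The Hilbert space `L²(𝕋ⁿ; ℝⁿ)` of square integrable vector fields. -/
abbrev L2Field (n : ℕ) : Type := Lp (Vec n) 2 (volume : Measure (Torus n))

/-- The partial derivative `∂_j f` of a real function on the torus. -/
def partialDeriv {n : ℕ} (j : Fin n) (f : Torus n → ℝ) (x : Torus n) : ℝ :=
  deriv (fun h : ℝ => f (x + Pi.single j (h : AddCircle (2 * π)))) 0

/-! ### Littlewood-Paley projections and Besov norms -/

/-- The character `x ↦ e^{i k·x}` of the torus. -/
def character {n : ℕ} (k : Fin n → ℤ) (x : Torus n) : ℂ := ∏ j, fourier (k j) (x j)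

/-- The Fourier coefficient `û(k) = (2π)⁻ⁿ ∫ u(x) e^{-i k·x} dx ∈ ℂⁿ` of a vector field. -/
def fourierCoefficient {n : ℕ} (u : Torus n → Vec n) (k : Fin n → ℤ) :
    EuclideanSpace ℂ (Fin n) :=
  WithLp.toLp 2 fun j => ((2 * π : ℝ) ^ n : ℂ)⁻¹ * ∫ x, character (-k) x * (u x j : ℂ)

/-- A lattice point `k ∈ ℤⁿ` as an element of `ℝⁿ`. -/
def latticeVec {n : ℕ} (k : Fin n → ℤ) : Vec n := WithLp.toLp 2 fun j => (k j : ℝ)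

/-- The cutoff functions `χ` from which a Littlewood-Paley decomposition is built: smooth,
nonnegative, radial, equal to `1` for `|ξ| ≤ 1/2` and to `0` for `|ξ| ≥ 1`. -/
structure IsCutoff {n : ℕ} (χ : Vec n → ℝ) : Prop where
  smooth : ContDiff ℝ ∞ χ
  nonneg : ∀ ξ, 0 ≤ χ ξ
  radial : ∀ ξ η, ‖ξ‖ = ‖η‖ → χ ξ = χ η
  eq_one : ∀ ξ, ‖ξ‖ ≤ 1 / 2 → χ ξ = 1
  eq_zero : ∀ ξ, 1 ≤ ‖ξ‖ → χ ξ = 0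

/-- The Littlewood-Paley symbols: `φ_{-1} = χ`, and `φ_q(ξ) = φ(2^{-q} ξ)` for `q ≥ 0`, where
`φ(ξ) = χ(ξ / 2) - χ(ξ)`. (Only indices `q ≥ -1` are ever used.) -/
def symbol {n : ℕ} (χ : Vec n → ℝ) (q : ℤ) (ξ : Vec n) : ℝ :=
  if q = -1 then χ ξ
  else χ ((2 : ℝ)⁻¹ • ((2 : ℝ) ^ (-q) • ξ)) - χ ((2 : ℝ) ^ (-q) • ξ)

/-- The Littlewood-Paley projection `u_q(x) = ∑_k û(k) φ_q(k) e^{i k·x}`; only finitely many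
terms of the sum are nonzero. -/
def lpBlock {n : ℕ} (χ : Vec n → ℝ) (u : Torus n → Vec n) (q : ℤ) (x : Torus n) :
    EuclideanSpace ℂ (Fin n) :=
  ∑' k : Fin n → ℤ, ((symbol χ q (latticeVec k) : ℂ) * character k x) • fourierCoefficient u k

/-- The norm `‖u‖_{B^s_{r,∞}} = sup_{q ≥ -1} 2^{qs} ‖u_q‖_{L^r}`, with values in `[0, ∞]`
(it is `∞` if `u` does not belong to `B^s_{r,∞}`). -/
def besovNorm {n : ℕ} (χ : Vec n → ℝ) (s : ℝ) (r : ℝ≥0∞) (u : Torus n → Vec n) : ℝ≥0∞ :=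
  ⨆ q ∈ Set.Ici (-1 : ℤ),
    ENNReal.ofReal ((2 : ℝ) ^ ((q : ℝ) * s)) * eLpNorm (lpBlock χ u q) r volume

/-! ### Weak solutions of the Euler equation -/

/-- `f` is divergence free in the sense of distributions on the torus. -/
def IsWeaklyDivFree {n : ℕ} (f : Torus n → Vec n) : Prop :=
  ∀ ψ : Torus n → ℝ, ContDiff ℝ ∞ (fun x : Fin n → ℝ => ψ (toTorus x)) →
    ∫ x, ∑ j, f x j * partialDeriv j ψ x = 0

/-- Divergence free test fields: smooth, compactly supported in `(0, T) × 𝕋ⁿ`. -/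
structure IsTestField {n : ℕ} (T : ℝ) (φ : ℝ → Torus n → Vec n) : Prop where
  smooth : ContDiff ℝ ∞ (fun p : ℝ × (Fin n → ℝ) => φ p.1 (toTorus p.2))
  support : ∃ a b : ℝ, 0 < a ∧ b < T ∧ ∀ t, t ∉ Set.Icc a b → ∀ x, φ t x = 0
  divFree : ∀ t x, ∑ j, partialDeriv j (fun y => φ t y j) x = 0

/-- Weak solutions on `[0, T)` of the Euler equation `u_t + (u·∇)u = -∇p`, `div u = 0`, on
the torus: `L²`-valued, weakly continuous, divergence free fields which satisfy the equation
in the sense of distributions. The pressure is eliminated by testing against divergence free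
fields, and `(u·∇)u = div (u ⊗ u)`. -/
structure IsWeakSolution {n : ℕ} (T : ℝ) (u : ℝ → L2Field n) : Prop where
  weaklyContinuous : ∀ g : L2Field n, ContinuousOn (fun t => inner ℝ g (u t)) (Set.Ico 0 T)
  divFree : ∀ t ∈ Set.Ico 0 T, IsWeaklyDivFree (u t : Torus n → Vec n)
  equation : ∀ φ : ℝ → Torus n → Vec n, IsTestField T φ →
    ∫ t in Set.Ioo 0 T, ∫ x,
      (∑ j, (u t x) j * deriv (fun τ => φ τ x j) t
        + ∑ i, ∑ j, (u t x) i * (u t x) j * partialDeriv i (fun y => φ t y j) x) = 0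

/-! ### The initial condition -/

/-- The cosine as a function on the circle `ℝ / 2πℤ`. -/
def circleCos : AddCircle (2 * π) → ℝ := Real.cos_periodic.lift

/-- The field `u₀(x) = e₁ cos x₂ + e₂ ∑_{q ≥ 0} 2^{-qs} cos(2^q x₁)` on the `n`-dimensional
torus, `n ≥ 2`; it depends on the first two coordinates only. -/
def initialField {n : ℕ} (hn : 2 ≤ n) (s : ℝ) (x : Torus n) : Vec n :=
  circleCos (x ⟨1, by omega⟩) • EuclideanSpace.single (⟨0, by omega⟩ : Fin n) (1 : ℝ)
    + (∑' q : ℕ, (2 : ℝ) ^ (-((q : ℝ) * s)) * circleCos ((2 ^ q : ℕ) • x ⟨0, by omega⟩))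
      • EuclideanSpace.single (⟨1, by omega⟩ : Fin n) (1 : ℝ)

end PeriodicEuler

end

open PeriodicEuler

noncomputable section

namespace PeriodicEuler

open scoped ComplexConjugate

variable {n : ℕ}

/-! ### Characters of the torus -/

/-! Suppose `u(t)` stays within a small distance of `u₀` in the Besov norm on some interval `(0,
τ)`. Write `θ = 2^(-s)`, let `i`, `j` be the first two coordinates and `k = 2^(Q+1) e_i + e_j`. The
shear `cos x_j` and the mode `q = Q + 1` of the lacunary series interact at `k`, so the product of
the first two components of `u₀` has coefficient exactly `θ^(Q+1) / 4` there, while the squares of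
both components have none. If the perturbation is small enough, every quadratic coefficient of
`u(t)` at `k` differs from that of `u₀` by at most a small multiple of `θ^Q`
(`IsCutoff.norm_coeff_component_mul_le`). The derivative in the Euler equation multiplies the mixed
coefficient by about `2^(Q+1)`, so a linear Fourier coefficient of `u(t)` must change at a rate of
order `(2θ)^Q`. Closeness to `u₀`, however, lets that coefficient vary by only `O(θ^Q)`. Testing
with one fixed bump in time bounds `2^Q` independently of `Q`, which is absurd
(`IsCutoff.not_blockBound`).

The analytic core is `IsCutoff.norm_integral_mul_mul_character_le`: if the blocks of two functions
decay like `A θ^p` in `L^ρ`, `ρ = min r 2`, then the coefficients of their product at `|k| ≥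
2^(Q+1)` are `O(A² θ^Q)`. Nikolskii's inequality gives `∫ |f_p| |g_q| ≤ A² θ^p (γθ)^q` with `γ =
2^(n(2/ρ-1))`, and the hypothesis on `s` says exactly that `γθ < 1`. Cross terms with `u₀` are
handled by explicit frequency shifts, and yield a bound linear in `A`. The perturbation therefore
has size `O(A + A²)`, with constants depending on `n`, `ρ`, `θ` alone, which fixes `δ` independently
of the solution.

As `u` is only weakly continuous in time, its linear Fourier coefficients are continuous, and its
quadratic ones are measurable as limits of finite convolutions (`coeff_mul_eq_tendsto`). -/

theorem character_add (k l : Fin n → ℤ) (x : Torus n) :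
    character (k + l) x = character k x * character l x := by
  simp only [character, Pi.add_apply, fourier_add, ← Finset.prod_mul_distrib]

theorem character_neg (k : Fin n → ℤ) (x : Torus n) :
    character (-k) x = conj (character k x) := by
  simp only [character, Pi.neg_apply, fourier_neg, map_prod]

theorem character_zero (x : Torus n) : character (0 : Fin n → ℤ) x = 1 := by
  simp [character]

theorem norm_character (k : Fin n → ℤ) (x : Torus n) : ‖character k x‖ = 1 := by
  rw [character, norm_prod]
  refine Finset.prod_eq_one fun j _ => ?_
  rw [fourier_apply]
  exact Circle.norm_coe _

theorem enorm_character (k : Fin n → ℤ) (x : Torus n) : ‖character k x‖ₑ = 1 := by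
  rw [← ofReal_norm, norm_character, ENNReal.ofReal_one]

@[fun_prop]
theorem continuous_character (k : Fin n → ℤ) : Continuous (character k) := by
  unfold character
  fun_prop

theorem character_translate (k : Fin n → ℤ) (x y : Torus n) :
    character k (x + y) = character k x * character k y := by
  simp only [character, Pi.add_apply, fourier_apply, smul_add, AddCircle.toCircle_add,
    Circle.coe_mul, Finset.prod_mul_distrib]

theorem character_toTorus (k : Fin n → ℤ) (x : Fin n → ℝ) :
    character k (toTorus x) = Complex.exp (((∑ j, k j * x j : ℝ) : ℂ) * Complex.I) := by
  simp only [character, toTorus, fourier_coe_apply, ← Complex.exp_sum]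
  congr 1
  push_cast
  rw [Finset.sum_mul]
  refine Finset.sum_congr rfl fun j _ => ?_
  have : (π : ℂ) ≠ 0 := by exact_mod_cast Real.pi_ne_zero
  field_simp

theorem toTorus_single (j : Fin n) (h : ℝ) :
    toTorus (Pi.single j h) = (Pi.single j (h : AddCircle (2 * π)) : Torus n) := by
  funext i
  by_cases hi : i = j
  · subst hi; simp [toTorus]
  · simp [toTorus, hi]

theorem toTorus_add (x y : Fin n → ℝ) : toTorus (x + y) = toTorus x + toTorus y := by
  funext i
  simp [toTorus]

theorem toTorus_surjective : Function.Surjective (toTorus (n := n)) := by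
  intro x
  choose y hy using fun j => QuotientAddGroup.mk_surjective (x j)
  exact ⟨y, funext hy⟩

theorem character_single (k : Fin n → ℤ) (j : Fin n) (h : ℝ) :
    character k (Pi.single j (h : AddCircle (2 * π))) = Complex.exp ((k j * h : ℝ) * Complex.I) := by
  rw [← toTorus_single, character_toTorus]
  congr 3
  rw [Finset.sum_eq_single j]
  · simp
  · intro i _ hi; simp [hi]
  · simp

/-- The volume of the torus. -/
def torusVolume (n : ℕ) : ℝ := (2 * π) ^ n

theorem torusVolume_pos (n : ℕ) : 0 < torusVolume n := by
  unfold torusVolume; positivity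

theorem volume_univ_torus : volume (Set.univ : Set (Torus n)) = ENNReal.ofReal (torusVolume n) := by
  rw [volume_pi, Measure.pi_univ]
  simp [AddCircle.measure_univ, torusVolume, ENNReal.ofReal_pow Real.two_pi_pos.le]

theorem integral_one_torus : ∫ _ : Torus n, (1 : ℂ) = torusVolume n := by
  simp [Measure.real, volume_univ_torus, (torusVolume_pos n).le]

/-- Translation invariance makes the integral equal to `c` times itself. This serves both the
orthogonality of characters and the vanishing of the two diagonal main terms. -/
theorem integral_eq_zero_of_translate {f : Torus n → ℂ} (y : Torus n) {c : ℂ} (hc : c ≠ 1)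
    (h : ∀ x, f (x + y) = c * f x) : ∫ x, f x = 0 := by
  have h1 : ∫ x, f (x + y) = ∫ x, f x := integral_add_right_eq_self f y
  simp only [h, integral_const_mul] at h1
  have : (c - 1) * ∫ x, f x = 0 := by rw [sub_mul, h1]; ring
  exact (mul_eq_zero.1 this).resolve_left (sub_ne_zero.2 hc)

theorem integral_character {k : Fin n → ℤ} (hk : k ≠ 0) : ∫ x, character k x = 0 := by
  obtain ⟨j, hj⟩ := Function.ne_iff.1 hk
  refine integral_eq_zero_of_translate (Pi.single j ((π / k j : ℝ) : AddCircle (2 * π)))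
    (c := -1) (by norm_num) fun x => ?_
  have hj' : (k j : ℝ) ≠ 0 := by exact_mod_cast hj
  rw [character_translate, character_single, mul_div_cancel₀ _ hj', Complex.exp_pi_mul_I]
  ring

theorem integral_character_eq (k : Fin n → ℤ) :
    ∫ x, character k x = if k = 0 then (torusVolume n : ℂ) else 0 := by
  split_ifs with h
  · subst h; simp only [character_zero, integral_one_torus]
  · exact integral_character h

/-! ### Fourier coefficients of scalar functions -/

/-- The Fourier coefficient of a scalar function. -/
def coeff (f : Torus n → ℂ) (k : Fin n → ℤ) : ℂ :=
  (torusVolume n : ℂ)⁻¹ * ∫ x, character (-k) x * f x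

theorem fourierCoefficient_apply (u : Torus n → Vec n) (k : Fin n → ℤ) (j : Fin n) :
    fourierCoefficient u k j = coeff (fun x => (u x j : ℂ)) k := by
  simp [fourierCoefficient, coeff, torusVolume]

theorem torusVolume_ne_zero : (torusVolume n : ℂ) ≠ 0 := by
  exact_mod_cast (torusVolume_pos n).ne'

theorem integral_character_mul (f : Torus n → ℂ) (k : Fin n → ℤ) :
    ∫ x, character k x * f x = torusVolume n * coeff f (-k) := by
  rw [coeff, neg_neg, mul_inv_cancel_left₀ torusVolume_ne_zero]

theorem integrable_character_mul {f : Torus n → ℂ} (hf : Integrable f) (k : Fin n → ℤ) :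
    Integrable (fun x => character k x * f x) := by
  refine hf.bdd_mul (c := 1) (continuous_character k).aestronglyMeasurable ?_
  exact Eventually.of_forall fun x => (norm_character k x).le

theorem coeff_sub {f g : Torus n → ℂ} (hf : Integrable f) (hg : Integrable g) (k : Fin n → ℤ) :
    coeff (fun x => f x - g x) k = coeff f k - coeff g k := by
  simp only [coeff, mul_sub]
  rw [integral_sub (integrable_character_mul hf _) (integrable_character_mul hg _), mul_sub]

theorem coeff_finset_sum {ι : Type*} (s : Finset ι) {f : ι → Torus n → ℂ}
    (hf : ∀ i ∈ s, Integrable (f i)) (k : Fin n → ℤ) :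
    coeff (fun x => ∑ i ∈ s, f i x) k = ∑ i ∈ s, coeff (f i) k := by
  simp only [coeff, Finset.mul_sum]
  rw [integral_finsetSum _ fun i hi => integrable_character_mul (hf i hi) _, Finset.mul_sum]

theorem coeff_const_mul (c : ℂ) (f : Torus n → ℂ) (k : Fin n → ℤ) :
    coeff (fun x => c * f x) k = c * coeff f k := by
  simp only [coeff, mul_left_comm _ c, integral_const_mul]

theorem coeff_character_mul (f : Torus n → ℂ) (m k : Fin n → ℤ) :
    coeff (fun x => character m x * f x) k = coeff f (k - m) := by
  simp only [coeff, ← mul_assoc, ← character_add]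
  rw [show -k + m = -(k - m) by abel]

theorem coeff_character (m k : Fin n → ℤ) :
    coeff (character m) k = if k = m then 1 else 0 := by
  have := integral_character_eq (-k + m)
  simp only [coeff, ← character_add, this]
  have h : -k + m = 0 ↔ k = m := by rw [neg_add_eq_zero]
  simp only [h]
  split_ifs
  · exact inv_mul_cancel₀ torusVolume_ne_zero
  · simp

/-! ### Density of trigonometric polynomials and Parseval's identity -/

/-- The characters as continuous maps. -/
def characterMap (k : Fin n → ℤ) : C(Torus n, ℂ) := ⟨character k, continuous_character k⟩

/-- The star subalgebra of trigonometric polynomials. -/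
def trigSubalgebra (n : ℕ) : StarSubalgebra ℂ C(Torus n, ℂ) where
  toSubalgebra := Algebra.adjoin ℂ (Set.range characterMap)
  star_mem' := by
    change Algebra.adjoin ℂ (Set.range characterMap) ≤ star (Algebra.adjoin ℂ (Set.range characterMap))
    refine Algebra.adjoin_le ?_
    rintro _ ⟨k, rfl⟩
    refine Algebra.subset_adjoin ⟨-k, ?_⟩
    ext1 x
    exact character_neg k x

/-- Characters are closed under products, so the algebra they generate is already their span.
Stone–Weierstrass concerns algebras, whereas a Hilbert basis needs a dense span. -/
theorem trigSubalgebra_coe :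
    (trigSubalgebra n).toSubalgebra.toSubmodule = Submodule.span ℂ (Set.range characterMap) := by
  apply Algebra.adjoin_eq_span_of_subset
  refine .trans (fun x ↦ Submonoid.closure_induction (fun _ ↦ id) ⟨0, ?_⟩ ?_) Submodule.subset_span
  · ext z
    exact character_zero z
  · rintro _ _ _ _ ⟨k, rfl⟩ ⟨l, rfl⟩
    refine ⟨k + l, ?_⟩
    ext z
    exact character_add k l z

theorem character_single_one (z : Torus n) (j : Fin n) :
    character (Pi.single j 1) z = fourier 1 (z j) := by
  rw [character, Finset.prod_eq_single j]
  · simp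
  · intro i _ hi; simp [hi]
  · simp

theorem trigSubalgebra_separatesPoints : (trigSubalgebra n).SeparatesPoints := by
  intro x y hxy
  obtain ⟨j, hj⟩ := Function.ne_iff.1 hxy
  refine ⟨_, ⟨characterMap (Pi.single j 1), Algebra.subset_adjoin ⟨Pi.single j 1, rfl⟩, rfl⟩, ?_⟩
  change character (Pi.single j 1) x ≠ character (Pi.single j 1) y
  rw [character_single_one, character_single_one, fourier_one, fourier_one]
  exact fun h => hj (AddCircle.injective_toCircle Real.two_pi_pos.ne' (Circle.coe_injective h))

theorem span_characterMap_closure_eq_top :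
    (Submodule.span ℂ (Set.range (characterMap (n := n)))).topologicalClosure = ⊤ := by
  rw [← trigSubalgebra_coe]
  exact congr_arg (Subalgebra.toSubmodule <| StarSubalgebra.toSubalgebra ·)
    (ContinuousMap.starSubalgebra_topologicalClosure_eq_top_of_separatesPoints _
      trigSubalgebra_separatesPoints)

/-- The normalised characters as elements of `L²`. -/
def characterLp (k : Fin n → ℤ) : Lp ℂ 2 (volume : Measure (Torus n)) :=
  ((√(torusVolume n))⁻¹ : ℂ) • ContinuousMap.toLp (E := ℂ) 2 volume ℂ (characterMap k)

theorem inner_characterLp (k : Fin n → ℤ) (f : Lp ℂ 2 (volume : Measure (Torus n))) :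
    inner ℂ (characterLp k) f = (√(torusVolume n) : ℂ) * coeff f k := by
  have h0 : (√(torusVolume n) : ℂ) ≠ 0 := by
    exact_mod_cast (Real.sqrt_pos.2 (torusVolume_pos n)).ne'
  have h1 : (torusVolume n : ℂ) = √(torusVolume n) * √(torusVolume n) := by
    exact_mod_cast (Real.mul_self_sqrt (torusVolume_pos n).le).symm
  have h2 : inner ℂ (ContinuousMap.toLp (E := ℂ) 2 volume ℂ (characterMap k)) f
      = ∫ x, character (-k) x * f x := by
    rw [L2.inner_def]
    refine integral_congr_ae ?_
    filter_upwards [ContinuousMap.coeFn_toLp (p := 2) (𝕜 := ℂ) volume (characterMap k)] with x hx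
    rw [hx, RCLike.inner_apply, character_neg, mul_comm]
    rfl
  rw [characterLp, inner_smul_left, h2, coeff, h1]
  simp only [map_inv₀, Complex.conj_ofReal]
  field_simp

theorem orthonormal_characterLp : Orthonormal ℂ (characterLp (n := n)) := by
  rw [orthonormal_iff_ite]
  intro k l
  have h0 : (√(torusVolume n) : ℂ) ≠ 0 := by
    exact_mod_cast (Real.sqrt_pos.2 (torusVolume_pos n)).ne'
  have h3 : coeff (characterLp l : Torus n → ℂ) k
      = coeff (fun x => ((√(torusVolume n))⁻¹ : ℂ) * character l x) k := by
    unfold coeff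
    congr 1
    refine integral_congr_ae ?_
    filter_upwards [ContinuousMap.coeFn_toLp (p := 2) (𝕜 := ℂ) volume (characterMap l),
      Lp.coeFn_smul ((√(torusVolume n))⁻¹ : ℂ)
        (ContinuousMap.toLp (E := ℂ) 2 volume ℂ (characterMap l))] with x hx hx'
    rw [characterLp, hx', Pi.smul_apply, hx]
    rfl
  rw [inner_characterLp, h3, coeff_const_mul, coeff_character, mul_inv_cancel_left₀ h0]

theorem span_characterLp_closure_eq_top :
    (Submodule.span ℂ (Set.range (characterLp (n := n)))).topologicalClosure = ⊤ := by
  have h1 : (Submodule.span ℂ (Set.range fun k : Fin n → ℤ =>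
      ContinuousMap.toLp (E := ℂ) 2 (volume : Measure (Torus n)) ℂ
        (characterMap k))).topologicalClosure = ⊤ := by
    simpa only [Submodule.map_span, ContinuousLinearMap.coe_coe, ← Set.range_comp,
      Function.comp_def] using
      (ContinuousMap.toLp_denseRange ℂ (volume : Measure (Torus n)) ℂ
        (p := 2) (by simp)).topologicalClosure_map_submodule span_characterMap_closure_eq_top
  rw [eq_top_iff, ← h1]
  refine Submodule.topologicalClosure_mono (Submodule.span_le.2 ?_)
  rintro _ ⟨k, rfl⟩
  have h0 : ((√(torusVolume n))⁻¹ : ℂ) ≠ 0 := by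
    exact_mod_cast (inv_pos.2 (Real.sqrt_pos.2 (torusVolume_pos n))).ne'
  have : characterLp k ∈ Submodule.span ℂ (Set.range (characterLp (n := n))) :=
    Submodule.subset_span ⟨k, rfl⟩
  exact (Submodule.smul_mem_iff _ h0).1 this

/-- The characters form a Hilbert basis of `L²`. -/
def characterBasis (n : ℕ) : HilbertBasis (Fin n → ℤ) ℂ (Lp ℂ 2 (volume : Measure (Torus n))) :=
  HilbertBasis.mk orthonormal_characterLp span_characterLp_closure_eq_top.ge

theorem coeff_congr_ae {f g : Torus n → ℂ} (h : f =ᵐ[volume] g) (k : Fin n → ℤ) :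
    coeff f k = coeff g k := by
  unfold coeff
  congr 1
  refine integral_congr_ae ?_
  filter_upwards [h] with x hx
  rw [hx]

theorem parseval {f : Torus n → ℂ} (hf : MemLp f 2) :
    HasSum (fun k => torusVolume n * ‖coeff f k‖ ^ 2) (∫ x, ‖f x‖ ^ 2) := by
  have h := (characterBasis n).hasSum_inner_mul_inner (hf.toLp f) (hf.toLp f)
  have h2 : inner ℂ (hf.toLp f) (hf.toLp f) = ((∫ x, ‖f x‖ ^ 2 : ℝ) : ℂ) := by
    rw [L2.inner_def, ← integral_complex_ofReal]
    refine integral_congr_ae ?_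
    filter_upwards [hf.coeFn_toLp] with x hx
    rw [hx, inner_self_eq_norm_sq_to_K]
    norm_cast
  rw [h2] at h
  have h3 := Complex.hasSum_re h
  rw [Complex.ofReal_re] at h3
  refine h3.congr_fun fun k => ?_
  have h4 : characterBasis n k = characterLp k := by
    rw [characterBasis, HilbertBasis.coe_mk]
  rw [← inner_conj_symm, h4, inner_characterLp, coeff_congr_ae hf.coeFn_toLp, Complex.conj_mul',
    norm_mul, Complex.norm_real, Real.norm_of_nonneg (Real.sqrt_nonneg _), ← Complex.ofReal_pow,
    Complex.ofReal_re, mul_pow, Real.sq_sqrt (torusVolume_pos n).le]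

/-! ### Trigonometric polynomials and Nikolskii's inequalities -/

/-- The trigonometric polynomial with frequencies in `Λ` and coefficients `a`. -/
def trigPoly (Λ : Finset (Fin n → ℤ)) (a : (Fin n → ℤ) → ℂ) (x : Torus n) : ℂ :=
  ∑ k ∈ Λ, a k * character k x

@[fun_prop]
theorem continuous_trigPoly (Λ : Finset (Fin n → ℤ)) (a : (Fin n → ℤ) → ℂ) :
    Continuous (trigPoly Λ a) := by
  unfold trigPoly
  fun_prop

theorem memLp_of_continuous {E : Type*} [NormedAddCommGroup E] {f : Torus n → E}
    (hf : Continuous f) (hm : AEStronglyMeasurable f volume) (p : ℝ≥0∞) : MemLp f p := by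
  obtain ⟨C, hC⟩ := isCompact_univ.exists_bound_of_continuousOn hf.continuousOn
  exact MemLp.of_bound hm C (Eventually.of_forall fun x => hC x trivial)

theorem memLp_trigPoly (Λ : Finset (Fin n → ℤ)) (a : (Fin n → ℤ) → ℂ) (p : ℝ≥0∞) :
    MemLp (trigPoly Λ a) p :=
  memLp_of_continuous (continuous_trigPoly Λ a) (continuous_trigPoly Λ a).aestronglyMeasurable p

theorem integrable_trigPoly (Λ : Finset (Fin n → ℤ)) (a : (Fin n → ℤ) → ℂ) :
    Integrable (trigPoly Λ a) := memLp_one_iff_integrable.1 (memLp_trigPoly Λ a 1)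

theorem integrable_character (k : Fin n → ℤ) : Integrable (character k) :=
  memLp_one_iff_integrable.1 (memLp_of_continuous (continuous_character k)
    (continuous_character k).aestronglyMeasurable 1)

theorem coeff_trigPoly (Λ : Finset (Fin n → ℤ)) (a : (Fin n → ℤ) → ℂ) (k : Fin n → ℤ) :
    coeff (trigPoly Λ a) k = if k ∈ Λ then a k else 0 := by
  unfold trigPoly
  rw [coeff_finset_sum _ fun i _ => (integrable_character i).const_mul _]
  simp only [coeff_const_mul, coeff_character, mul_ite, mul_one, mul_zero, Finset.sum_ite_eq]

theorem integral_trigPoly_sq (Λ : Finset (Fin n → ℤ)) (a : (Fin n → ℤ) → ℂ) :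
    ∫ x, ‖trigPoly Λ a x‖ ^ 2 = torusVolume n * ∑ k ∈ Λ, ‖a k‖ ^ 2 := by
  have h := parseval (memLp_trigPoly Λ a 2)
  rw [Finset.mul_sum]
  refine h.unique ?_
  rw [Finset.sum_congr rfl fun k hk => (by rw [coeff_trigPoly, if_pos hk] :
    torusVolume n * ‖a k‖ ^ 2 = torusVolume n * ‖coeff (trigPoly Λ a) k‖ ^ 2)]
  exact hasSum_sum_of_ne_finset_zero fun k hk => by simp [coeff_trigPoly, hk]

theorem eLpNorm_ofReal_rpow {f : Torus n → ℂ} {ρ : ℝ} (hρ : 0 < ρ) :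
    eLpNorm f (ENNReal.ofReal ρ) volume ^ ρ = ∫⁻ x, ‖f x‖ₑ ^ ρ := by
  rw [eLpNorm_eq_lintegral_rpow_enorm_toReal (by simpa using hρ) (by simp),
    ENNReal.toReal_ofReal hρ.le, ← ENNReal.rpow_mul, one_div_mul_cancel hρ.ne', ENNReal.rpow_one]

theorem eLpNorm_two_eq {f : Torus n → ℂ} (hf : MemLp f 2) :
    eLpNorm f 2 volume = ENNReal.ofReal √(∫ x, ‖f x‖ ^ 2) := by
  rw [hf.eLpNorm_eq_integral_rpow_norm (by simp) (by simp)]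
  simp [Real.sqrt_eq_rpow]

/-- Cauchy–Schwarz over the frequencies, then Parseval. `K` bounds the number of frequencies divided
by the volume of the torus. -/
theorem enorm_trigPoly_le {Λ : Finset (Fin n → ℤ)} (a : (Fin n → ℤ) → ℂ) {K : ℝ}
    (hK : Λ.card ≤ K * torusVolume n) (x : Torus n) :
    ‖trigPoly Λ a x‖ₑ ≤ ENNReal.ofReal K ^ (1 / 2 : ℝ) * eLpNorm (trigPoly Λ a) 2 volume := by
  have hV := torusVolume_pos n
  have hK0 : 0 ≤ K := by
    by_contra! h
    have : (0 : ℝ) ≤ Λ.card := by positivity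
    nlinarith
  rw [eLpNorm_two_eq (memLp_trigPoly Λ a 2), ENNReal.ofReal_rpow_of_nonneg hK0 (by norm_num),
    ← ENNReal.ofReal_mul (by positivity), ← Real.sqrt_eq_rpow, ← Real.sqrt_mul hK0,
    ← ofReal_norm]
  refine ENNReal.ofReal_le_ofReal (Real.le_sqrt_of_sq_le ?_)
  rw [integral_trigPoly_sq]
  have h1 : ‖trigPoly Λ a x‖ ≤ ∑ k ∈ Λ, ‖a k‖ := by
    refine (norm_sum_le _ _).trans_eq (Finset.sum_congr rfl fun k _ => ?_)
    rw [norm_mul, norm_character, mul_one]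
  calc ‖trigPoly Λ a x‖ ^ 2 ≤ (∑ k ∈ Λ, ‖a k‖) ^ 2 := by gcongr
    _ ≤ Λ.card * ∑ k ∈ Λ, ‖a k‖ ^ 2 := sq_sum_le_card_mul_sum_sq
    _ ≤ K * torusVolume n * ∑ k ∈ Λ, ‖a k‖ ^ 2 := by gcongr
    _ = _ := by ring

/-- Nikolskii's inequality between `L^ρ` and `L^2`. -/
theorem eLpNorm_two_trigPoly_le {Λ : Finset (Fin n → ℤ)} (a : (Fin n → ℤ) → ℂ) {K : ℝ}
    (hK : Λ.card ≤ K * torusVolume n) {ρ : ℝ} (h1 : 1 ≤ ρ) (h2 : ρ ≤ 2) :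
    eLpNorm (trigPoly Λ a) 2 volume
      ≤ ENNReal.ofReal K ^ (1 / ρ - 1 / 2) * eLpNorm (trigPoly Λ a) (ENNReal.ofReal ρ) volume := by
  set A := trigPoly Λ a with hA
  set N := eLpNorm A 2 volume with hN
  set R := eLpNorm A (ENNReal.ofReal ρ) volume with hR
  have hρ : 0 < ρ := by linarith
  have hNtop : N ≠ ⊤ := (memLp_trigPoly Λ a 2).eLpNorm_ne_top
  rcases eq_or_ne N 0 with h0 | h0
  · rw [h0]; exact zero_le
  -- Interpolation `‖A‖₂² ≤ ‖A‖_∞^(2-ρ) ‖A‖_ρ^ρ`, with the supremum controlled by `N` itself.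
  -- Cancelling `N ^ (2 - ρ)` afterwards needs `N` nonzero and finite.
  have key : N ^ (2 : ℝ) ≤ (ENNReal.ofReal K ^ (1 / 2 : ℝ) * N) ^ (2 - ρ) * R ^ ρ := by
    have : N = eLpNorm A (ENNReal.ofReal 2) volume := by rw [hN]; norm_num
    rw [this, eLpNorm_ofReal_rpow two_pos, hR, eLpNorm_ofReal_rpow hρ, ← this,
      ← lintegral_const_mul' _ _ (by
        refine ENNReal.rpow_ne_top_of_nonneg (by linarith) (ENNReal.mul_ne_top ?_ hNtop)
        exact ENNReal.rpow_ne_top_of_nonneg (by norm_num) ENNReal.ofReal_ne_top)]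
    refine lintegral_mono fun x => ?_
    calc ‖A x‖ₑ ^ (2 : ℝ) = ‖A x‖ₑ ^ (2 - ρ) * ‖A x‖ₑ ^ ρ := by
          rw [← ENNReal.rpow_add_of_nonneg _ _ (by linarith) hρ.le]; congr 1; ring
      _ ≤ _ := by
          gcongr
          exact enorm_trigPoly_le a hK x
  rw [ENNReal.mul_rpow_of_nonneg _ _ (by linarith), ← ENNReal.rpow_mul] at key
  have key2 : N ^ ρ ≤ ENNReal.ofReal K ^ (1 / 2 * (2 - ρ)) * R ^ ρ := by
    have hc0 : N ^ (2 - ρ) ≠ 0 := by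
      simp [ENNReal.rpow_eq_zero_iff, h0, hNtop]
    have hct : N ^ (2 - ρ) ≠ ⊤ := ENNReal.rpow_ne_top_of_nonneg (by linarith) hNtop
    rw [← ENNReal.mul_le_mul_iff_right hc0 hct]
    calc N ^ (2 - ρ) * N ^ ρ = N ^ (2 : ℝ) := by
          rw [← ENNReal.rpow_add_of_nonneg _ _ (by linarith) hρ.le]; congr 1; ring
      _ ≤ _ := key.trans_eq (by ring)
  have := ENNReal.rpow_le_rpow key2 (z := 1 / ρ) (by positivity)
  rw [ENNReal.mul_rpow_of_nonneg _ _ (by positivity), ← ENNReal.rpow_mul, ← ENNReal.rpow_mul,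
    ← ENNReal.rpow_mul, mul_one_div_cancel hρ.ne', ENNReal.rpow_one, ENNReal.rpow_one] at this
  convert this using 3
  field_simp

/-- A bilinear form of Nikolskii's inequality between `L^ρ` and its dual. -/
theorem lintegral_trigPoly_mul_le {Λ : Finset (Fin n → ℤ)} (a : (Fin n → ℤ) → ℂ) {K : ℝ}
    (hK : Λ.card ≤ K * torusVolume n) {ρ : ℝ} (h1 : 1 ≤ ρ) (h2 : ρ ≤ 2)
    {B : Torus n → ℂ} (hB : AEStronglyMeasurable B volume) :
    ∫⁻ x, ‖trigPoly Λ a x‖ₑ * ‖B x‖ₑ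
      ≤ ENNReal.ofReal K ^ (2 / ρ - 1) * eLpNorm (trigPoly Λ a) (ENNReal.ofReal ρ) volume
        * eLpNorm B (ENNReal.ofReal ρ) volume := by
  have hρ : 0 < ρ := by linarith
  set A := trigPoly Λ a with hA
  set R := eLpNorm A (ENNReal.ofReal ρ) volume with hR
  set S := eLpNorm B (ENNReal.ofReal ρ) volume with hS
  have hRtop : R ≠ ⊤ := (memLp_trigPoly Λ a _).eLpNorm_ne_top
  have hbound : ∀ x, ‖A x‖ₑ ≤ ENNReal.ofReal K ^ (1 / ρ) * R := fun x => by
    refine (enorm_trigPoly_le a hK x).trans ?_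
    refine (mul_le_mul_right (eLpNorm_two_trigPoly_le a hK h1 h2) _).trans_eq ?_
    rw [← mul_assoc, ← ENNReal.rpow_add_of_nonneg _ _ (by norm_num) (by
      rw [sub_nonneg]; exact one_div_le_one_div_of_le hρ h2)]
    congr 2
    ring
  -- Hölder in the form with weights `(ρ - 1)/ρ` and `1/ρ`, which includes `ρ = 1` without an
  -- infinite dual exponent. The remaining power `|A|^(2-ρ)` is bounded by the supremum.
  have hol : ∫⁻ x, ‖A x‖ₑ ^ (ρ - 1) * ‖B x‖ₑ ≤ R ^ (ρ - 1) * S := by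
    have := ENNReal.lintegral_mul_norm_pow_le (μ := (volume : Measure (Torus n)))
      (f := fun x => ‖A x‖ₑ ^ ρ) (g := fun x => ‖B x‖ₑ ^ ρ)
      ((continuous_trigPoly Λ a).aestronglyMeasurable.enorm.pow_const _)
      (hB.enorm.pow_const _) (p := (ρ - 1) / ρ) (q := 1 / ρ)
      (div_nonneg (by linarith) hρ.le) (by positivity) (by field_simp; ring)
    rw [← eLpNorm_ofReal_rpow hρ, ← eLpNorm_ofReal_rpow hρ] at this
    simp only [← ENNReal.rpow_mul, mul_div_cancel₀ _ hρ.ne', ENNReal.rpow_one] at this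
    exact this
  have hC : (ENNReal.ofReal K ^ (1 / ρ) * R) ^ (2 - ρ) ≠ ⊤ :=
    ENNReal.rpow_ne_top_of_nonneg (by linarith) (ENNReal.mul_ne_top
      (ENNReal.rpow_ne_top_of_nonneg (by positivity) ENNReal.ofReal_ne_top) hRtop)
  calc ∫⁻ x, ‖A x‖ₑ * ‖B x‖ₑ
      ≤ ∫⁻ x, (ENNReal.ofReal K ^ (1 / ρ) * R) ^ (2 - ρ) * (‖A x‖ₑ ^ (ρ - 1) * ‖B x‖ₑ) := by
        refine lintegral_mono fun x => ?_
        rw [← mul_assoc]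
        gcongr
        calc ‖A x‖ₑ = ‖A x‖ₑ ^ (2 - ρ) * ‖A x‖ₑ ^ (ρ - 1) := by
              rw [← ENNReal.rpow_add_of_nonneg _ _ (by linarith) (by linarith)]
              rw [show 2 - ρ + (ρ - 1) = 1 by ring, ENNReal.rpow_one]
          _ ≤ _ := by
              gcongr
              exact hbound x
    _ = (ENNReal.ofReal K ^ (1 / ρ) * R) ^ (2 - ρ) * ∫⁻ x, ‖A x‖ₑ ^ (ρ - 1) * ‖B x‖ₑ :=
        lintegral_const_mul' _ _ hC
    _ ≤ (ENNReal.ofReal K ^ (1 / ρ) * R) ^ (2 - ρ) * (R ^ (ρ - 1) * S) := by gcongr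
    _ = _ := by
        rw [ENNReal.mul_rpow_of_nonneg _ _ (by linarith), ← ENNReal.rpow_mul]
        have e1 : R ^ (2 - ρ) * R ^ (ρ - 1) = R := by
          rw [← ENNReal.rpow_add_of_nonneg _ _ (by linarith) (by linarith)]
          rw [show 2 - ρ + (ρ - 1) = 1 by ring, ENNReal.rpow_one]
        have e2 : 1 / ρ * (2 - ρ) = 2 / ρ - 1 := by field_simp
        rw [e2]
        calc _ = ENNReal.ofReal K ^ (2 / ρ - 1) * (R ^ (2 - ρ) * R ^ (ρ - 1)) * S := by ring
          _ = _ := by rw [e1]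

variable {χ : Vec n → ℝ}

/-! ### Littlewood-Paley blocks of scalar functions -/

/-- The symbol `χ(2^{-Q} k)` of the low frequency cutoff. -/
def lowPass (χ : Vec n → ℝ) (Q : ℕ) (k : Fin n → ℤ) : ℝ :=
  χ ((2 : ℝ) ^ (-(Q : ℤ)) • latticeVec k)

/-- The Littlewood-Paley symbols on the lattice, indexed from `0`. -/
def blockSymbol (χ : Vec n → ℝ) : ℕ → (Fin n → ℤ) → ℝ
  | 0, k => lowPass χ 0 k
  | p + 1, k => lowPass χ (p + 1) k - lowPass χ p k

/-- The shift `q = p - 1` makes the indices natural numbers and exhibits the blocks as differences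
of consecutive low-pass symbols, hence telescoping. -/
theorem symbol_eq_blockSymbol (p : ℕ) (k : Fin n → ℤ) :
    symbol χ ((p : ℤ) - 1) (latticeVec k) = blockSymbol χ p k := by
  cases p with
  | zero => simp [symbol, blockSymbol, lowPass]
  | succ p =>
    have h : ((p + 1 : ℕ) : ℤ) - 1 = p := by push_cast; ring
    have h' : (p : ℤ) ≠ -1 := by omega
    rw [h, symbol, if_neg h', blockSymbol]
    unfold lowPass
    rw [smul_smul]
    congr 3
    rw [Nat.cast_succ, neg_add, zpow_add₀ two_ne_zero, mul_comm]
    simp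

/-- The frequencies `k` with `|k_j| ≤ 2^Q`. -/
def box (n Q : ℕ) : Finset (Fin n → ℤ) :=
  Fintype.piFinset fun _ => Finset.Icc (-2 ^ Q) (2 ^ Q)

theorem mem_box {Q : ℕ} {k : Fin n → ℤ} : k ∈ box n Q ↔ ∀ j, |k j| ≤ 2 ^ Q := by
  simp [box, Fintype.mem_piFinset, abs_le]

theorem box_mono {P Q : ℕ} (h : P ≤ Q) : box n P ⊆ box n Q := fun k hk => by
  rw [mem_box] at hk ⊢
  exact fun j => (hk j).trans (pow_le_pow_right₀ (by norm_num) h)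

theorem card_box_le (n Q : ℕ) : ((box n Q).card : ℝ) ≤ ((2 : ℝ) ^ n) ^ Q * torusVolume n := by
  have h : (box n Q).card = (2 * 2 ^ Q + 1) ^ n := by
    rw [box, Fintype.card_piFinset]
    simp only [Int.card_Icc, Finset.prod_const, Finset.card_univ, Fintype.card_fin]
    congr 1
    zify
    rw [Int.toNat_of_nonneg (by have : (0 : ℤ) < 2 ^ Q := (by positivity); omega)]
    ring
  rw [h, torusVolume, ← pow_mul, mul_comm n Q, pow_mul, ← mul_pow]
  push_cast
  gcongr
  -- Per coordinate, `2 * 2^Q + 1 ≤ 3 * 2^Q ≤ 2π * 2^Q`: the volume absorbs every constant.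
  have h1 : (1 : ℝ) ≤ 2 ^ Q := one_le_pow₀ (by norm_num)
  nlinarith [Real.pi_gt_three]

theorem abs_le_norm_latticeVec (k : Fin n → ℤ) (j : Fin n) : |(k j : ℝ)| ≤ ‖latticeVec k‖ := by
  have h := PiLp.norm_apply_le (latticeVec k) j
  simpa [latticeVec] using h

theorem latticeVec_add (k l : Fin n → ℤ) : latticeVec (k + l) = latticeVec k + latticeVec l := by
  ext j; simp [latticeVec]

theorem norm_smul_latticeVec (Q : ℕ) (k : Fin n → ℤ) :
    ‖(2 : ℝ) ^ (-(Q : ℤ)) • latticeVec k‖ = ‖latticeVec k‖ / 2 ^ Q := by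
  rw [norm_smul, zpow_neg, zpow_natCast, norm_inv, norm_pow, Real.norm_ofNat, div_eq_inv_mul]

theorem IsCutoff.lowPass_eq_zero (hχ : IsCutoff χ) {Q : ℕ} {k : Fin n → ℤ}
    (h : 2 ^ Q ≤ ‖latticeVec k‖) : lowPass χ Q k = 0 := by
  refine hχ.eq_zero _ ?_
  rwa [norm_smul_latticeVec, le_div_iff₀ (by positivity), one_mul]

theorem IsCutoff.lowPass_eq_one (hχ : IsCutoff χ) {Q : ℕ} {k : Fin n → ℤ}
    (h : 2 * ‖latticeVec k‖ ≤ 2 ^ Q) : lowPass χ Q k = 1 := by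
  refine hχ.eq_one _ ?_
  rw [norm_smul_latticeVec, div_le_div_iff₀ (by positivity) two_pos]
  linarith

theorem IsCutoff.lowPass_eq_zero_of_notMem (hχ : IsCutoff χ) {Q : ℕ} {k : Fin n → ℤ}
    (h : k ∉ box n Q) : lowPass χ Q k = 0 := by
  rw [mem_box] at h
  push Not at h
  obtain ⟨j, hj⟩ := h
  refine hχ.lowPass_eq_zero (le_trans ?_ (abs_le_norm_latticeVec k j))
  exact_mod_cast hj.le

theorem IsCutoff.eventually_lowPass_eq_one (hχ : IsCutoff χ) (k : Fin n → ℤ) :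
    ∀ᶠ Q in atTop, lowPass χ Q k = 1 := by
  filter_upwards [(tendsto_pow_atTop_atTop_of_one_lt (one_lt_two (α := ℝ))).eventually_ge_atTop
    (2 * ‖latticeVec k‖)] with Q hQ
  exact hχ.lowPass_eq_one hQ

theorem IsCutoff.exists_bound (hχ : IsCutoff χ) : ∃ M, ∀ ξ, ‖χ ξ‖ ≤ M := by
  refine hχ.smooth.continuous.bounded_above_of_compact_support ?_
  refine HasCompactSupport.of_support_subset_isCompact (isCompact_closedBall (0 : Vec n) 1) ?_
  intro ξ hξ
  rw [mem_closedBall_zero_iff]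
  by_contra! h
  exact hξ (hχ.eq_zero ξ h.le)

theorem IsCutoff.blockSymbol_eq_zero (hχ : IsCutoff χ) {p : ℕ} {k : Fin n → ℤ}
    (h : k ∉ box n p) : blockSymbol χ p k = 0 := by
  cases p with
  | zero => exact hχ.lowPass_eq_zero_of_notMem h
  | succ p =>
    rw [blockSymbol, hχ.lowPass_eq_zero_of_notMem h,
      hχ.lowPass_eq_zero_of_notMem fun h' => h (box_mono p.le_succ h'), sub_zero]

/-- The low frequency part of `f`. -/
def lowBlock (χ : Vec n → ℝ) (Q : ℕ) (f : Torus n → ℂ) : Torus n → ℂ :=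
  trigPoly (box n Q) fun k => lowPass χ Q k * coeff f k

/-- The Littlewood-Paley blocks of `f`, indexed from `0`. -/
def block (χ : Vec n → ℝ) (p : ℕ) (f : Torus n → ℂ) : Torus n → ℂ :=
  trigPoly (box n p) fun k => blockSymbol χ p k * coeff f k

theorem trigPoly_of_subset {Λ Λ' : Finset (Fin n → ℤ)} (h : Λ ⊆ Λ') {a : (Fin n → ℤ) → ℂ}
    (ha : ∀ k ∉ Λ, a k = 0) : trigPoly Λ a = trigPoly Λ' a := by
  funext x
  exact Finset.sum_subset h fun k _ hk => by rw [ha k hk, zero_mul]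

theorem IsCutoff.coeff_lowBlock (hχ : IsCutoff χ) (Q : ℕ) (f : Torus n → ℂ) (k : Fin n → ℤ) :
    coeff (lowBlock χ Q f) k = lowPass χ Q k * coeff f k := by
  rw [lowBlock, coeff_trigPoly]
  split_ifs with h
  · rfl
  · simp [hχ.lowPass_eq_zero_of_notMem h]

theorem IsCutoff.coeff_block (hχ : IsCutoff χ) (p : ℕ) (f : Torus n → ℂ) (k : Fin n → ℤ) :
    coeff (block χ p f) k = blockSymbol χ p k * coeff f k := by
  rw [block, coeff_trigPoly]
  split_ifs with h
  · rfl
  · simp [hχ.blockSymbol_eq_zero h]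

theorem IsCutoff.lowBlock_succ (hχ : IsCutoff χ) (Q : ℕ) (f : Torus n → ℂ) (x : Torus n) :
    lowBlock χ (Q + 1) f x = lowBlock χ Q f x + block χ (Q + 1) f x := by
  have h : lowBlock χ Q f = trigPoly (box n (Q + 1)) fun k => lowPass χ Q k * coeff f k :=
    trigPoly_of_subset (box_mono Q.le_succ) fun k hk => by
      simp [hχ.lowPass_eq_zero_of_notMem hk]
  rw [h]
  simp only [lowBlock, block, trigPoly, ← Finset.sum_add_distrib, blockSymbol]
  refine Finset.sum_congr rfl fun k _ => ?_
  push_cast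
  ring

theorem lowBlock_zero (f : Torus n → ℂ) : lowBlock χ 0 f = block χ 0 f := rfl

theorem IsCutoff.lowBlock_eq_sum (hχ : IsCutoff χ) (Q : ℕ) (f : Torus n → ℂ) (x : Torus n) :
    lowBlock χ Q f x = ∑ p ∈ Finset.range (Q + 1), block χ p f x := by
  induction Q with
  | zero => simp [lowBlock_zero]
  | succ Q ih => rw [hχ.lowBlock_succ, ih, Finset.sum_range_succ _ (Q + 1)]

theorem IsCutoff.lowBlock_sub_lowBlock (hχ : IsCutoff χ) {Q N : ℕ} (h : Q ≤ N) (f : Torus n → ℂ)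
    (x : Torus n) :
    lowBlock χ N f x - lowBlock χ Q f x = ∑ p ∈ Finset.Ico Q N, block χ (p + 1) f x := by
  rw [← Finset.sum_Ico_sub (fun Q => lowBlock χ Q f x) h]
  exact Finset.sum_congr rfl fun p _ => by rw [hχ.lowBlock_succ, add_sub_cancel_left]

theorem continuous_block (p : ℕ) (f : Torus n → ℂ) : Continuous (block χ p f) :=
  continuous_trigPoly _ _

theorem memLp_lowBlock (Q : ℕ) (f : Torus n → ℂ) (r : ℝ≥0∞) : MemLp (lowBlock χ Q f) r :=
  memLp_trigPoly _ _ _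

theorem IsCutoff.lpBlock_apply (hχ : IsCutoff χ) (u : Torus n → Vec n) (p : ℕ) (x : Torus n)
    (j : Fin n) :
    lpBlock χ u ((p : ℤ) - 1) x j = block χ p (fun y => (u y j : ℂ)) x := by
  unfold lpBlock
  rw [tsum_eq_sum (s := box n p) fun k hk => by
    rw [symbol_eq_blockSymbol, hχ.blockSymbol_eq_zero hk]; simp]
  simp only [WithLp.ofLp_sum, Finset.sum_apply, PiLp.smul_apply, smul_eq_mul, block, trigPoly,
    symbol_eq_blockSymbol, fourierCoefficient_apply]
  exact Finset.sum_congr rfl fun k _ => by ring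

/-! ### Convergence in `L²` -/

theorem integrable_of_memLp_two {E : Type*} [NormedAddCommGroup E] {f : Torus n → E}
    (hf : MemLp f 2) : Integrable f :=
  hf.integrable (by norm_num)

/-- Parseval and dominated convergence over frequencies: `1 - lowPass χ N k` is bounded uniformly
and vanishes once `N` is large for the given `k`. -/
theorem IsCutoff.tendsto_eLpNorm_sub_lowBlock (hχ : IsCutoff χ) {f : Torus n → ℂ}
    (hf : MemLp f 2) :
    Tendsto (fun N => eLpNorm (fun x => f x - lowBlock χ N f x) 2 volume) atTop (𝓝 0) := by
  obtain ⟨M, hM⟩ := hχ.exists_bound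
  have hmem : ∀ N, MemLp (fun x => f x - lowBlock χ N f x) 2 := fun N =>
    hf.sub (memLp_lowBlock N f 2)
  have hint := integrable_of_memLp_two hf
  have hsum : ∀ N, ∫ x, ‖f x - lowBlock χ N f x‖ ^ 2
      = ∑' k, torusVolume n * ‖(1 - lowPass χ N k : ℂ) * coeff f k‖ ^ 2 := fun N => by
    rw [← (parseval (hmem N)).tsum_eq]
    refine tsum_congr fun k => ?_
    rw [coeff_sub hint (integrable_of_memLp_two (memLp_lowBlock N f 2)), hχ.coeff_lowBlock]
    congr 3
    ring
  have hlim : Tendsto (fun N => ∫ x, ‖f x - lowBlock χ N f x‖ ^ 2) atTop (𝓝 0) := by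
    simp only [hsum]
    have := tendsto_tsum_of_dominated_convergence (𝓕 := atTop)
      (f := fun N (k : Fin n → ℤ) => torusVolume n * ‖(1 - lowPass χ N k : ℂ) * coeff f k‖ ^ 2)
      (g := fun _ => (0 : ℝ))
      (bound := fun k => (1 + M) ^ 2 * (torusVolume n * ‖coeff f k‖ ^ 2))
      ((parseval hf).summable.mul_left _) ?_ ?_
    · simpa using this
    · intro k
      refine tendsto_const_nhds.congr' ?_
      filter_upwards [hχ.eventually_lowPass_eq_one k] with N hN
      simp [hN]
    · refine Eventually.of_forall fun N k => ?_
      have h1 : ‖(1 - lowPass χ N k : ℂ)‖ ≤ 1 + M := by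
        refine (norm_sub_le _ _).trans ?_
        rw [norm_one, Complex.norm_real]
        gcongr
        exact hM _
      have := torusVolume_pos n
      rw [Real.norm_of_nonneg (by positivity), norm_mul, mul_pow]
      calc _ ≤ torusVolume n * ((1 + M) ^ 2 * ‖coeff f k‖ ^ 2) := by gcongr
        _ = _ := by ring
  simp only [eLpNorm_two_eq (hmem _)]
  rw [← ENNReal.ofReal_zero, ← Real.sqrt_zero]
  exact (ENNReal.continuous_ofReal.tendsto _).comp ((Real.continuous_sqrt.tendsto _).comp hlim)

/-- The blocks between `Q` and `N` telescope and sum geometrically, uniformly in `N`; the remainder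
beyond `N` tends to zero in `L²`. -/
theorem IsCutoff.eLpNorm_sub_lowBlock_le (hχ : IsCutoff χ) {f : Torus n → ℂ} (hf : MemLp f 2)
    {A θ : ℝ} (hA : 0 ≤ A) (h0 : 0 ≤ θ) (h1 : θ < 1)
    (h : ∀ p, eLpNorm (block χ p f) 2 volume ≤ ENNReal.ofReal (A * θ ^ p)) (Q : ℕ) :
    eLpNorm (fun x => f x - lowBlock χ Q f x) 2 volume
      ≤ ENNReal.ofReal (A * (θ ^ Q / (1 - θ))) := by
  have hsum : ∀ N, eLpNorm (∑ p ∈ Finset.Ico Q N, block χ (p + 1) f) 2 volume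
      ≤ ENNReal.ofReal (A * (θ ^ Q / (1 - θ))) := fun N => calc
    eLpNorm (∑ p ∈ Finset.Ico Q N, block χ (p + 1) f) 2 volume
      ≤ ∑ p ∈ Finset.Ico Q N, eLpNorm (block χ (p + 1) f) 2 volume :=
        eLpNorm_sum_le (fun p _ => (continuous_block (p + 1) f).aestronglyMeasurable) one_le_two
    _ ≤ ∑ p ∈ Finset.Ico Q N, ENNReal.ofReal (A * θ ^ p) := by
        refine Finset.sum_le_sum fun p _ => (h _).trans (ENNReal.ofReal_le_ofReal ?_)
        gcongr A * ?_
        exact pow_le_pow_of_le_one h0 h1.le p.le_succ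
    _ = ENNReal.ofReal (A * ∑ p ∈ Finset.Ico Q N, θ ^ p) := by
        rw [Finset.mul_sum, ENNReal.ofReal_sum_of_nonneg fun p _ => by positivity]
    _ ≤ _ := by
        refine ENNReal.ofReal_le_ofReal ?_
        gcongr
        exact geom_sum_Ico_le_of_lt_one h0 h1
  have hN : ∀ N ≥ Q, eLpNorm (fun x => f x - lowBlock χ Q f x) 2 volume
      ≤ eLpNorm (fun x => f x - lowBlock χ N f x) 2 volume
        + ENNReal.ofReal (A * (θ ^ Q / (1 - θ))) := fun N hN => by
    have e : (fun x => f x - lowBlock χ Q f x) = (fun x => f x - lowBlock χ N f x)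
        + ∑ p ∈ Finset.Ico Q N, block χ (p + 1) f := by
      funext x
      simp only [Pi.add_apply, Finset.sum_apply, ← hχ.lowBlock_sub_lowBlock hN]
      ring
    rw [e]
    refine (eLpNorm_add_le (hf.sub (memLp_lowBlock N f 2)).1
      (Finset.aestronglyMeasurable_sum _ fun p _ =>
        (continuous_block (p + 1) f).aestronglyMeasurable) one_le_two).trans ?_
    exact add_le_add_right (hsum N) _
  have := (hχ.tendsto_eLpNorm_sub_lowBlock hf).add_const (ENNReal.ofReal (A * (θ ^ Q / (1 - θ))))
  rw [zero_add] at this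
  exact ge_of_tendsto this (eventually_atTop.2 ⟨Q, hN⟩)

/-! ### Pairings with trigonometric polynomials of high frequency -/

theorem integral_mul_trigPoly {f : Torus n → ℂ} (hf : Integrable f) (Λ : Finset (Fin n → ℤ))
    (b : (Fin n → ℤ) → ℂ) :
    ∫ x, f x * trigPoly Λ b x = ∑ l ∈ Λ, b l * (torusVolume n * coeff f (-l)) := by
  simp only [trigPoly, Finset.mul_sum]
  rw [integral_finsetSum]
  · refine Finset.sum_congr rfl fun l _ => ?_
    rw [← integral_character_mul, ← integral_const_mul]
    congr 1
    funext x
    ring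
  · intro l _
    convert (integrable_character_mul hf l).const_mul (b l) using 2
    ring

/-- Only blocks of index above `Q` meet the active frequencies. The spectrum being finite, some `N`
has low-pass symbol `1` on all of it, so the pairing is exactly a finite sum of block pairings. The
sign in `-l` appears because integrating against `e^{il·x}` reads off the coefficient at `-l`. -/
theorem IsCutoff.norm_integral_mul_trigPoly_le (hχ : IsCutoff χ) {f : Torus n → ℂ}
    (hf : Integrable f) {Λ : Finset (Fin n → ℤ)} {b : (Fin n → ℤ) → ℂ} {Q : ℕ}
    (hΛ : ∀ l ∈ Λ, b l ≠ 0 → lowPass χ Q (-l) = 0) {B θ : ℝ} (hB : 0 ≤ B) (h0 : 0 ≤ θ)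
    (h1 : θ < 1)
    (h : ∀ p, ∫⁻ x, ‖block χ p f x‖ₑ * ‖trigPoly Λ b x‖ₑ ≤ ENNReal.ofReal (B * θ ^ p)) :
    ‖∫ x, f x * trigPoly Λ b x‖ ≤ B * (θ ^ Q / (1 - θ)) := by
  have hev : ∀ᶠ N in atTop, ∀ l ∈ Λ, lowPass χ N (-l) = 1 :=
    (eventually_all_finset Λ).2 fun l _ => hχ.eventually_lowPass_eq_one (-l)
  obtain ⟨N, hN, hQN⟩ := (hev.and (eventually_ge_atTop Q)).exists
  have hsum : ∫ x, f x * trigPoly Λ b x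
      = ∑ p ∈ Finset.Ico Q N, ∫ x, block χ (p + 1) f x * trigPoly Λ b x := by
    rw [integral_mul_trigPoly hf]
    simp only [integral_mul_trigPoly (integrable_trigPoly _ _), block]
    rw [Finset.sum_comm]
    refine Finset.sum_congr rfl fun l hl => ?_
    by_cases hb : b l = 0
    · simp [hb]
    have e : ∀ p, coeff (trigPoly (box n (p + 1)) fun k => blockSymbol χ (p + 1) k * coeff f k) (-l)
        = ((lowPass χ (p + 1) (-l) - lowPass χ p (-l) : ℝ) : ℂ) * coeff f (-l) :=
      fun p => hχ.coeff_block (p + 1) f (-l)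
    simp only [e]
    rw [← Finset.mul_sum, ← Finset.mul_sum, ← Finset.sum_mul, ← Complex.ofReal_sum,
      Finset.sum_Ico_sub (fun p => lowPass χ p (-l)) hQN, hN l hl, hΛ l hl hb]
    simp
  rw [hsum]
  calc ‖∑ p ∈ Finset.Ico Q N, ∫ x, block χ (p + 1) f x * trigPoly Λ b x‖
      ≤ ∑ p ∈ Finset.Ico Q N, B * θ ^ p := by
        refine norm_sum_le_of_le _ fun p _ => ?_
        have h2 : ‖∫ x, block χ (p + 1) f x * trigPoly Λ b x‖ₑ ≤ ENNReal.ofReal (B * θ ^ (p + 1)) := by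
          refine (enorm_integral_le_lintegral_enorm _).trans ?_
          simpa only [enorm_mul] using h (p + 1)
        rw [← ofReal_norm, ENNReal.ofReal_le_ofReal_iff (by positivity)] at h2
        refine h2.trans ?_
        gcongr B * ?_
        exact pow_le_pow_of_le_one h0 h1.le p.le_succ
    _ = B * ∑ p ∈ Finset.Ico Q N, θ ^ p := by rw [Finset.mul_sum]
    _ ≤ _ := by
        gcongr
        exact geom_sum_Ico_le_of_lt_one h0 h1

/-! ### Functions with geometrically decaying blocks -/

/-- The `L^ρ` norms of the blocks of `f` decay like `A θ^p`. -/
def BlockBound (χ : Vec n → ℝ) (ρ A θ : ℝ) (f : Torus n → ℂ) : Prop :=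
  ∀ p, eLpNorm (block χ p f) (ENNReal.ofReal ρ) volume ≤ ENNReal.ofReal (A * θ ^ p)

/-- The loss per dyadic scale in the embedding of `L^ρ` into its dual, `γ = 2^{n(2/ρ - 1)}`. -/
def bernsteinConst (n : ℕ) (ρ : ℝ) : ℝ := ((2 : ℝ) ^ n) ^ (2 / ρ - 1)

theorem two_div_sub_one_nonneg {ρ : ℝ} (h1 : 1 ≤ ρ) (h2 : ρ ≤ 2) : 0 ≤ 2 / ρ - 1 := by
  rw [sub_nonneg, le_div_iff₀ (by linarith)]; linarith

theorem one_le_bernsteinConst {ρ : ℝ} (h1 : 1 ≤ ρ) (h2 : ρ ≤ 2) : 1 ≤ bernsteinConst n ρ :=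
  Real.one_le_rpow (one_le_pow₀ (by norm_num)) (two_div_sub_one_nonneg h1 h2)

theorem sqrt_bernsteinConst_le {ρ : ℝ} (h1 : 1 ≤ ρ) (h2 : ρ ≤ 2) :
    √(bernsteinConst n ρ) ≤ bernsteinConst n ρ := by
  have h := one_le_bernsteinConst (n := n) h1 h2
  rw [Real.sqrt_le_left (by linarith)]
  nlinarith

theorem one_le_torusVolume (n : ℕ) : 1 ≤ torusVolume n :=
  one_le_pow₀ (by linarith [Real.pi_gt_three])

/-- Going from `L^ρ` to `L²` costs the exponent `1/ρ - 1/2`, half the one in `bernsteinConst`; hence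
the square root. -/
theorem BlockBound.eLpNorm_two_le {ρ A θ : ℝ} {f : Torus n → ℂ} (hf : BlockBound χ ρ A θ f)
    (h1 : 1 ≤ ρ) (h2 : ρ ≤ 2) (p : ℕ) :
    eLpNorm (block χ p f) 2 volume
      ≤ ENNReal.ofReal (A * (√(bernsteinConst n ρ) * θ) ^ p) := by
  refine (eLpNorm_two_trigPoly_le _ (card_box_le n p) h1 h2).trans ?_
  refine (mul_le_mul_right (hf p) _).trans_eq ?_
  have hb : (0 : ℝ) ≤ 2 ^ n := by positivity
  rw [ENNReal.ofReal_rpow_of_pos (by positivity), ← ENNReal.ofReal_mul (by positivity)]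
  congr 1
  rw [bernsteinConst, Real.sqrt_eq_rpow, ← Real.rpow_mul hb, mul_pow, ← Real.rpow_mul_natCast hb,
    ← Real.rpow_natCast (2 ^ n) p, ← Real.rpow_mul hb, mul_left_comm]
  congr 3
  ring

/-- Nikolskii's inequality is applied to the block of `g` alone, so `f` keeps its full decay. In
use, `g` is the low-frequency factor. -/
theorem BlockBound.lintegral_mul_block_le {ρ A B θ : ℝ} {f g : Torus n → ℂ}
    (hf : BlockBound χ ρ A θ f) (hg : BlockBound χ ρ B θ g) (hB : 0 ≤ B) (h0 : 0 ≤ θ)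
    (h1 : 1 ≤ ρ) (h2 : ρ ≤ 2) (p q : ℕ) :
    ∫⁻ x, ‖block χ p f x‖ₑ * ‖block χ q g x‖ₑ
      ≤ ENNReal.ofReal (A * B * θ ^ p * (bernsteinConst n ρ * θ) ^ q) := by
  have h := lintegral_trigPoly_mul_le (fun k => blockSymbol χ q k * coeff g k) (card_box_le n q)
    h1 h2 (continuous_block (χ := χ) p f).aestronglyMeasurable
  have hb : (0 : ℝ) ≤ 2 ^ n := by positivity
  calc ∫⁻ x, ‖block χ p f x‖ₑ * ‖block χ q g x‖ₑ
      = ∫⁻ x, ‖block χ q g x‖ₑ * ‖block χ p f x‖ₑ := by simp only [mul_comm]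
    _ ≤ ENNReal.ofReal ((2 ^ n) ^ q) ^ (2 / ρ - 1) * ENNReal.ofReal (B * θ ^ q)
          * ENNReal.ofReal (A * θ ^ p) :=
        h.trans (mul_le_mul' (mul_le_mul_right (hg q) _) (hf p))
    _ = _ := by
        rw [ENNReal.ofReal_rpow_of_pos (by positivity), ← ENNReal.ofReal_mul (by positivity),
          ← ENNReal.ofReal_mul (by positivity)]
        congr 1
        rw [bernsteinConst, mul_pow, ← Real.rpow_mul_natCast hb,
          ← Real.rpow_natCast (2 ^ n) q, ← Real.rpow_mul hb, mul_comm (2 / ρ - 1) (q : ℝ)]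
        ring

/-- The loss sits on the low-frequency factor, where `γθ < 1` makes the sum over its blocks bounded
independently of `Q`. -/
theorem IsCutoff.lintegral_block_mul_lowBlock_le (hχ : IsCutoff χ) {ρ A B θ : ℝ}
    {f g : Torus n → ℂ} (hf : BlockBound χ ρ A θ f) (hg : BlockBound χ ρ B θ g)
    (hA : 0 ≤ A) (hB : 0 ≤ B) (h0 : 0 ≤ θ)
    (h1 : 1 ≤ ρ) (h2 : ρ ≤ 2) (hγ : bernsteinConst n ρ * θ < 1) (p Q : ℕ) :
    ∫⁻ x, ‖block χ p f x‖ₑ * ‖lowBlock χ Q g x‖ₑ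
      ≤ ENNReal.ofReal (A * B / (1 - bernsteinConst n ρ * θ) * θ ^ p) := by
  have hγ0 : 0 ≤ bernsteinConst n ρ * θ :=
    mul_nonneg (by linarith [one_le_bernsteinConst (n := n) h1 h2]) h0
  calc ∫⁻ x, ‖block χ p f x‖ₑ * ‖lowBlock χ Q g x‖ₑ
      ≤ ∫⁻ x, ∑ q ∈ Finset.range (Q + 1), ‖block χ p f x‖ₑ * ‖block χ q g x‖ₑ := by
        refine lintegral_mono fun x => ?_
        rw [hχ.lowBlock_eq_sum, ← Finset.mul_sum]
        exact mul_le_mul_right (enorm_sum_le _ _) _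
    _ = ∑ q ∈ Finset.range (Q + 1), ∫⁻ x, ‖block χ p f x‖ₑ * ‖block χ q g x‖ₑ :=
        lintegral_finsetSum' _ fun q _ => (continuous_block p f).aestronglyMeasurable.enorm.mul
          (continuous_block q g).aestronglyMeasurable.enorm
    _ ≤ ∑ q ∈ Finset.range (Q + 1),
          ENNReal.ofReal (A * B * θ ^ p * (bernsteinConst n ρ * θ) ^ q) :=
        Finset.sum_le_sum fun q _ => hf.lintegral_mul_block_le hg hB h0 h1 h2 p q
    _ = ENNReal.ofReal (A * B * θ ^ p * ∑ q ∈ Finset.range (Q + 1),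
          (bernsteinConst n ρ * θ) ^ q) := by
        rw [Finset.mul_sum, ENNReal.ofReal_sum_of_nonneg fun q _ => by positivity]
    _ ≤ _ := by
        refine ENNReal.ofReal_le_ofReal ?_
        have h3 : ∑ q ∈ Finset.Ico 0 (Q + 1), (bernsteinConst n ρ * θ) ^ q
            ≤ (bernsteinConst n ρ * θ) ^ 0 / (1 - bernsteinConst n ρ * θ) :=
          geom_sum_Ico_le_of_lt_one hγ0 hγ
        rw [pow_zero, Nat.Ico_zero_eq_range] at h3
        calc A * B * θ ^ p * ∑ q ∈ Finset.range (Q + 1), (bernsteinConst n ρ * θ) ^ q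
            ≤ A * B * θ ^ p * (1 / (1 - bernsteinConst n ρ * θ)) := by gcongr
          _ = _ := by ring

theorem BlockBound.lintegral_le {ρ A θ : ℝ} {f : Torus n → ℂ} (hf : BlockBound χ ρ A θ f)
    (h1 : 1 ≤ ρ) (p : ℕ) :
    ∫⁻ x, ‖block χ p f x‖ₑ ≤ ENNReal.ofReal (torusVolume n * A * θ ^ p) := by
  have hV := one_le_torusVolume n
  have hp : (1 : ℝ≥0∞) ≤ ENNReal.ofReal ρ := by
    rw [← ENNReal.ofReal_one]; exact ENNReal.ofReal_le_ofReal h1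
  have h := eLpNorm_le_eLpNorm_mul_rpow_measure_univ (μ := volume) hp
    (continuous_block (χ := χ) p f).aestronglyMeasurable
  rw [eLpNorm_one_eq_lintegral_enorm, volume_univ_torus, ENNReal.toReal_ofReal (by linarith),
    ENNReal.toReal_one, div_one, ENNReal.ofReal_rpow_of_pos (torusVolume_pos n)] at h
  refine h.trans ((mul_le_mul_left (hf p) _).trans ?_)
  rw [mul_comm, ← ENNReal.ofReal_mul (by positivity), mul_assoc]
  have hexp : torusVolume n ^ (1 - 1 / ρ) ≤ torusVolume n := by
    conv_rhs => rw [← Real.rpow_one (torusVolume n)]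
    refine Real.rpow_le_rpow_of_exponent_le hV ?_
    have : 0 ≤ 1 / ρ := by positivity
    linarith
  rcases le_total 0 (A * θ ^ p) with h3 | h3
  · exact ENNReal.ofReal_le_ofReal (mul_le_mul_of_nonneg_right hexp h3)
  · rw [ENNReal.ofReal_of_nonpos (mul_nonpos_of_nonneg_of_nonpos (by positivity) h3)]
    exact zero_le

/-- Pairing with a single character uses only `L¹` norms of blocks, so there is no Nikolskii loss
and `θ < 1` suffices. -/
theorem IsCutoff.norm_coeff_le_of_blockBound (hχ : IsCutoff χ) {ρ A θ : ℝ} {f : Torus n → ℂ}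
    (hfi : Integrable f) (hf : BlockBound χ ρ A θ f) (hA : 0 ≤ A) (h0 : 0 ≤ θ) (hθ : θ < 1)
    (h1 : 1 ≤ ρ) {Q : ℕ} {k : Fin n → ℤ} (hk : 2 ^ Q ≤ ‖latticeVec k‖) :
    ‖coeff f k‖ ≤ A * (θ ^ Q / (1 - θ)) := by
  have hV := torusVolume_pos n
  have ht : trigPoly {-k} (fun _ => 1) = character (-k) := by
    funext x; simp [trigPoly]
  have h := hχ.norm_integral_mul_trigPoly_le hfi (Λ := {-k}) (b := fun _ => 1) (Q := Q)
    (B := torusVolume n * A) (θ := θ)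
    (fun l hl _ => by
      rw [Finset.mem_singleton.1 hl, neg_neg]; exact hχ.lowPass_eq_zero hk)
    (by positivity) h0 hθ (fun p => by
      simpa only [ht, enorm_character, mul_one] using hf.lintegral_le h1 p)
  simp only [ht, mul_comm (f _)] at h
  rw [integral_character_mul, neg_neg, norm_mul, Complex.norm_real, Real.norm_of_nonneg hV.le,
    mul_assoc] at h
  exact le_of_mul_le_mul_left h hV

/-! ### High-frequency Fourier coefficients of products -/

theorem trigPoly_mul_character (Λ : Finset (Fin n → ℤ)) (a : (Fin n → ℤ) → ℂ) (m : Fin n → ℤ)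
    (x : Torus n) :
    trigPoly Λ a x * character m x
      = trigPoly (Λ.map (addRightEmbedding m)) (fun l => a (l - m)) x := by
  simp [trigPoly, Finset.sum_mul, character_add, mul_assoc]

theorem lintegral_enorm_mul_le {f g : Torus n → ℂ} (hf : AEStronglyMeasurable f volume)
    (hg : AEStronglyMeasurable g volume) :
    ∫⁻ x, ‖f x‖ₑ * ‖g x‖ₑ ≤ eLpNorm f 2 volume * eLpNorm g 2 volume := by
  have h := eLpNorm_smul_le_mul_eLpNorm (p := 2) (q := 2) (r := 1) hg hf
  rw [eLpNorm_one_eq_lintegral_enorm] at h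
  simpa only [Pi.smul_apply', smul_eq_mul, enorm_mul] using h

theorem memLp_two_mul {f g : Torus n → ℂ} (hf : MemLp f 2) (hg : MemLp g 2) :
    Integrable (fun x => f x * g x) := hf.integrable_mul hg

theorem integrable_mul_character {f : Torus n → ℂ} (hf : Integrable f) (k : Fin n → ℤ) :
    Integrable (fun x => f x * character k x) := by
  simpa only [mul_comm] using integrable_character_mul hf k

/-- The Fourier coefficients of a product decay like those of its factors. -/
theorem IsCutoff.norm_integral_mul_mul_character_le (hχ : IsCutoff χ) {ρ A θ : ℝ}
    {f g : Torus n → ℂ} (hfm : MemLp f 2) (hgm : MemLp g 2)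
    (hf : BlockBound χ ρ A θ f) (hg : BlockBound χ ρ A θ g)
    (hA : 0 ≤ A) (h0 : 0 ≤ θ) (hθ : θ < 1)
    (h1 : 1 ≤ ρ) (h2 : ρ ≤ 2) (hγ : bernsteinConst n ρ * θ < 1) {Q : ℕ} {k : Fin n → ℤ}
    (hk : 2 ^ (Q + 1) ≤ ‖latticeVec k‖) :
    ‖∫ x, f x * g x * character (-k) x‖
      ≤ (2 / ((1 - bernsteinConst n ρ * θ) * (1 - θ))
          + 1 / (1 - √(bernsteinConst n ρ) * θ) ^ 2) * (A ^ 2 * θ ^ Q) := by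
  set γ := bernsteinConst n ρ with hγdef
  have hγ1 : 1 ≤ γ := one_le_bernsteinConst h1 h2
  have hβ : √γ * θ < 1 :=
    (mul_le_mul_of_nonneg_right (sqrt_bernsteinConst_le h1 h2) h0).trans_lt hγ
  have hβ0 : 0 ≤ √γ * θ := by positivity
  have hγ0 : 0 < 1 - γ * θ := by linarith
  have hθ0 : 0 < 1 - θ := by linarith
  have hβ1 : 0 < 1 - √γ * θ := by linarith
  -- The spectrum of this product lies within `2^Q` of `-k`, and `|k| ≥ 2^(Q+1)`, so it avoids the
  -- open ball of radius `2^Q`.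
  have hS : ∀ h : Torus n → ℂ, ∃ Λ b, (∀ l ∈ Λ, b l ≠ 0 → lowPass χ Q (-l) = 0) ∧
      ∀ x, trigPoly Λ b x = lowBlock χ Q h x * character (-k) x := fun h => by
    refine ⟨_, _, ?_, fun x => (trigPoly_mul_character _ _ _ x).symm⟩
    intro l _ hl
    have hl' : ‖latticeVec (l + k)‖ < 2 ^ Q := by
      by_contra! hc
      refine hl ?_
      rw [sub_neg_eq_add, hχ.lowPass_eq_zero hc, Complex.ofReal_zero, zero_mul]
    refine hχ.lowPass_eq_zero ?_
    have e : latticeVec k = latticeVec (l + k) + latticeVec (-l) := by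
      rw [← latticeVec_add]; congr 1; abel
    have h3 := norm_add_le (latticeVec (l + k)) (latticeVec (-l))
    rw [← e] at h3
    rw [pow_succ] at hk
    linarith
  have hlow : ∀ f g : Torus n → ℂ, Integrable f → BlockBound χ ρ A θ f → BlockBound χ ρ A θ g →
      ‖∫ x, f x * (lowBlock χ Q g x * character (-k) x)‖
        ≤ A * A / (1 - γ * θ) * (θ ^ Q / (1 - θ)) := by
    intro f g hfi hf hg
    obtain ⟨Λ, b, hΛ, hb⟩ := hS g
    simp only [← hb]
    refine hχ.norm_integral_mul_trigPoly_le hfi hΛ (by positivity) h0 hθ fun p => ?_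
    simp only [hb, enorm_mul, enorm_character, mul_one]
    exact hχ.lintegral_block_mul_lowBlock_le hf hg hA hA h0 h1 h2 hγ p Q
  -- Two frequencies of length below `2^Q` cannot add up to `k`.
  have hlowlow : ∫ x, lowBlock χ Q f x * (lowBlock χ Q g x * character (-k) x) = 0 := by
    obtain ⟨Λ, b, hΛ, hb⟩ := hS g
    simp only [← hb]
    rw [integral_mul_trigPoly (f := lowBlock χ Q f) (integrable_trigPoly _ _)]
    refine Finset.sum_eq_zero fun l hl => ?_
    by_cases hbl : b l = 0
    · simp [hbl]
    · have e : coeff (lowBlock χ Q f) (-l) = 0 := by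
        rw [hχ.coeff_lowBlock, hΛ l hl hbl, Complex.ofReal_zero, zero_mul]
      simp [e]
  have hhigh : ‖∫ x, (f x - lowBlock χ Q f x) * (g x - lowBlock χ Q g x) * character (-k) x‖
      ≤ 1 / (1 - √γ * θ) ^ 2 * (A ^ 2 * θ ^ Q) := by
    have hfh := hχ.eLpNorm_sub_lowBlock_le hfm hA hβ0 hβ (hf.eLpNorm_two_le h1 h2) Q
    have hgh := hχ.eLpNorm_sub_lowBlock_le hgm hA hβ0 hβ (hg.eLpNorm_two_le h1 h2) Q
    have h4 : ‖∫ x, (f x - lowBlock χ Q f x) * (g x - lowBlock χ Q g x) * character (-k) x‖ₑ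
        ≤ ENNReal.ofReal (A * ((√γ * θ) ^ Q / (1 - √γ * θ))
          * (A * ((√γ * θ) ^ Q / (1 - √γ * θ)))) := by
      refine (enorm_integral_le_lintegral_enorm _).trans ?_
      simp only [enorm_mul, enorm_character, mul_one]
      refine (lintegral_enorm_mul_le (hfm.sub (memLp_lowBlock Q f 2)).1
        (hgm.sub (memLp_lowBlock Q g 2)).1).trans ?_
      rw [ENNReal.ofReal_mul (by positivity)]
      exact mul_le_mul' hfh hgh
    rw [← ofReal_norm, ENNReal.ofReal_le_ofReal_iff (by positivity)] at h4
    refine h4.trans ?_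
    -- The two `L²` tails multiply to `(γθ · θ)^Q`, and `γθ < 1` recovers the full rate `θ^Q`.
    have h5 : (√γ * θ) ^ Q * (√γ * θ) ^ Q ≤ θ ^ Q := by
      rw [← mul_pow]
      refine pow_le_pow_left₀ (by positivity) ?_ Q
      rw [mul_mul_mul_comm, Real.mul_self_sqrt (by linarith), ← mul_assoc]
      exact mul_le_of_le_one_left h0 hγ.le
    calc A * ((√γ * θ) ^ Q / (1 - √γ * θ)) * (A * ((√γ * θ) ^ Q / (1 - √γ * θ)))
        = 1 / (1 - √γ * θ) ^ 2 * (A ^ 2 * ((√γ * θ) ^ Q * (√γ * θ) ^ Q)) := by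
          field_simp
      _ ≤ _ := by gcongr
  have hfi := integrable_of_memLp_two hfm
  have hgi := integrable_of_memLp_two hgm
  have hlf := memLp_lowBlock (χ := χ) Q f 2
  have hlg := memLp_lowBlock (χ := χ) Q g 2
  have i1 := integrable_mul_character (memLp_two_mul hfm hlg) (-k)
  have i2 := integrable_mul_character (memLp_two_mul hgm hlf) (-k)
  have i3 := integrable_mul_character (memLp_two_mul hlf hlg) (-k)
  simp only [mul_assoc (_ : ℂ) (lowBlock _ _ _ _)] at i1 i2 i3
  -- With `S` the low-pass operator, `fg = f Sg + g Sf - Sf Sg + (f - Sf)(g - Sg)`.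
  have hsplit : ∫ x, f x * g x * character (-k) x
      = (∫ x, f x * (lowBlock χ Q g x * character (-k) x))
        + (∫ x, g x * (lowBlock χ Q f x * character (-k) x))
        - (∫ x, lowBlock χ Q f x * (lowBlock χ Q g x * character (-k) x))
        + ∫ x, (f x - lowBlock χ Q f x) * (g x - lowBlock χ Q g x) * character (-k) x := by
    have j1 : Integrable fun x => f x * (lowBlock χ Q g x * character (-k) x)
        + g x * (lowBlock χ Q f x * character (-k) x) := i1.add i2
    have j2 : Integrable fun x => f x * (lowBlock χ Q g x * character (-k) x)
        + g x * (lowBlock χ Q f x * character (-k) x)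
        - lowBlock χ Q f x * (lowBlock χ Q g x * character (-k) x) := j1.sub i3
    have j3 : Integrable fun x => (f x - lowBlock χ Q f x) * (g x - lowBlock χ Q g x)
        * character (-k) x :=
      integrable_mul_character (memLp_two_mul (hfm.sub hlf) (hgm.sub hlg)) (-k)
    rw [← integral_add i1 i2, ← integral_sub j1 i3, ← integral_add j2 j3]
    congr 1
    funext x
    ring
  rw [hsplit, hlowlow, sub_zero]
  refine (norm_add₃_le).trans ?_
  calc _ ≤ A * A / (1 - γ * θ) * (θ ^ Q / (1 - θ)) + A * A / (1 - γ * θ) * (θ ^ Q / (1 - θ))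
        + 1 / (1 - √γ * θ) ^ 2 * (A ^ 2 * θ ^ Q) :=
        add_le_add_three (hlow f g hfi hf hg) (hlow g f hgi hg hf) hhigh
    _ = _ := by
        field_simp
        ring

/-! ### Cosine series and the initial field -/

theorem circleCos_coe (t : ℝ) : circleCos (t : AddCircle (2 * π)) = Real.cos t :=
  Real.cos_periodic.lift_coe t

theorem continuous_circleCos : Continuous circleCos :=
  continuous_coinduced_dom.2 (by simpa only [Function.comp_def] using! Real.continuous_cos)

theorem abs_circleCos_le (t : AddCircle (2 * π)) : |circleCos t| ≤ 1 := by
  obtain ⟨y, rfl⟩ := QuotientAddGroup.mk_surjective t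
  exact (congrArg abs (circleCos_coe y)).trans_le (Real.abs_cos_le_one y)

theorem circleCos_nsmul (m : ℕ) (j : Fin n) (x : Torus n) :
    (circleCos (m • x j) : ℂ)
      = (character (Pi.single j (m : ℤ)) x + character (-Pi.single j (m : ℤ)) x) / 2 := by
  obtain ⟨y, rfl⟩ := toTorus_surjective x
  have h1 : m • (toTorus y j) = ((m * y j : ℝ) : AddCircle (2 * π)) := by
    rw [toTorus, ← nsmul_eq_mul]
    rfl
  have h2 : ∑ i, ((Pi.single j (m : ℤ) : Fin n → ℤ) i : ℝ) * y i = m * y j := by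
    rw [Finset.sum_eq_single j]
    · simp
    · intro i _ hi; simp [hi]
    · simp
  have h3 : ∑ i, ((-Pi.single j (m : ℤ) : Fin n → ℤ) i : ℝ) * y i = -(m * y j) := by
    rw [← h2, ← Finset.sum_neg_distrib]
    simp
  rw [h1, circleCos_coe, character_toTorus, character_toTorus, h2, h3, Complex.ofReal_cos,
    Complex.cos, Complex.ofReal_neg]

theorem coeff_mul_circleCos {f : Torus n → ℂ} (hf : Integrable f) (m : ℕ) (j : Fin n)
    (k : Fin n → ℤ) :
    coeff (fun x => f x * (circleCos (m • x j) : ℂ)) k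
      = (coeff f (k - Pi.single j (m : ℤ)) + coeff f (k + Pi.single j (m : ℤ))) / 2 := by
  have e : (fun x => f x * (circleCos (m • x j) : ℂ))
      = fun x => (1 / 2 : ℂ) * ∑ i : Fin 2, character
        ((![Pi.single j (m : ℤ), -Pi.single j (m : ℤ)] : Fin 2 → Fin n → ℤ) i) x * f x := by
    funext x
    rw [circleCos_nsmul, Fin.sum_univ_two]
    simp only [Matrix.cons_val_zero, Matrix.cons_val_one]
    ring
  rw [e, coeff_const_mul, coeff_finset_sum _ fun i _ => integrable_character_mul hf _,
    Fin.sum_univ_two]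
  simp only [Matrix.cons_val_zero, Matrix.cons_val_one, coeff_character_mul, sub_neg_eq_add]
  ring

theorem continuous_circleCos_nsmul (m : ℕ) (j : Fin n) :
    Continuous fun x : Torus n => circleCos (m • x j) :=
  continuous_circleCos.comp ((continuous_apply j).nsmul m)

/-- The lacunary cosine series `∑ θ^q cos(2^q x_j)`. -/
def cosSeries (θ : ℝ) (j : Fin n) (x : Torus n) : ℝ :=
  ∑' q : ℕ, θ ^ q * circleCos ((2 ^ q : ℕ) • x j)

theorem norm_cosSeries_term_le {θ : ℝ} (h0 : 0 ≤ θ) (j : Fin n) (q : ℕ) (x : Torus n) :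
    ‖θ ^ q * circleCos ((2 ^ q : ℕ) • x j)‖ ≤ θ ^ q := by
  rw [norm_mul, Real.norm_of_nonneg (by positivity)]
  exact mul_le_of_le_one_right (by positivity) (abs_circleCos_le _)

theorem continuous_cosSeries {θ : ℝ} (h0 : 0 ≤ θ) (h1 : θ < 1) (j : Fin n) :
    Continuous (cosSeries θ j) :=
  continuous_tsum (fun _ => continuous_const.mul (continuous_circleCos_nsmul _ j))
    (summable_geometric_of_lt_one h0 h1) fun q x => norm_cosSeries_term_le h0 j q x

/-- Termwise integration is justified by the majorant `θ^q |f|`; each cosine shifts the frequency by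
`±2^q e_j`. -/
theorem hasSum_coeff_mul_cosSeries {f : Torus n → ℂ} (hf : Integrable f) {θ : ℝ} (h0 : 0 ≤ θ)
    (h1 : θ < 1) (j : Fin n) (k : Fin n → ℤ) :
    HasSum (fun q : ℕ => (θ ^ q : ℂ) * ((coeff f (k - Pi.single j ((2 ^ q : ℕ) : ℤ))
        + coeff f (k + Pi.single j ((2 ^ q : ℕ) : ℤ))) / 2))
      (coeff (fun x => f x * (cosSeries θ j x : ℂ)) k) := by
  have hterm : ∀ (q : ℕ) x, ‖character (-k) x * (f x * ((θ ^ q * circleCos ((2 ^ q : ℕ) • x j) : ℝ) : ℂ))‖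
      ≤ θ ^ q * ‖f x‖ := fun q x => by
    rw [norm_mul, norm_mul, norm_character, one_mul, mul_comm, Complex.norm_real]
    exact mul_le_mul_of_nonneg_right (norm_cosSeries_term_le h0 j q x) (norm_nonneg _)
  have hint : ∀ q : ℕ, Integrable fun x => character (-k) x *
      (f x * ((θ ^ q * circleCos ((2 ^ q : ℕ) • x j) : ℝ) : ℂ)) := fun q => by
    refine integrable_character_mul (hf.mul_bdd (c := θ ^ q) ?_ ?_) _
    · exact (Complex.continuous_ofReal.comp
        (continuous_const.mul (continuous_circleCos_nsmul _ j))).aestronglyMeasurable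
    · refine Eventually.of_forall fun x => ?_
      rw [Complex.norm_real]
      exact norm_cosSeries_term_le h0 j q x
  have hsum : Summable fun q : ℕ => ∫ x, ‖character (-k) x *
      (f x * ((θ ^ q * circleCos ((2 ^ q : ℕ) • x j) : ℝ) : ℂ))‖ := by
    refine Summable.of_nonneg_of_le (fun q => integral_nonneg fun x => norm_nonneg _)
      (fun q => ?_) ((summable_geometric_of_lt_one h0 h1).mul_right (∫ x, ‖f x‖))
    rw [← integral_const_mul]
    exact integral_mono (hint q).norm (hf.norm.const_mul _) (hterm q)
  have h := (hasSum_integral_of_summable_integral_norm hint hsum).mul_left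
    ((torusVolume n : ℂ)⁻¹)
  have e1 : ∀ q : ℕ, (torusVolume n : ℂ)⁻¹ * ∫ x, character (-k) x *
      (f x * ((θ ^ q * circleCos ((2 ^ q : ℕ) • x j) : ℝ) : ℂ))
      = (θ ^ q : ℂ) * ((coeff f (k - Pi.single j ((2 ^ q : ℕ) : ℤ))
        + coeff f (k + Pi.single j ((2 ^ q : ℕ) : ℤ))) / 2) := fun q => by
    rw [← coeff_mul_circleCos hf, ← coeff_const_mul, coeff]
    congr 2
    funext x
    push_cast
    ring
  have e2 : ∀ x, ∑' q : ℕ, character (-k) x *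
      (f x * ((θ ^ q * circleCos ((2 ^ q : ℕ) • x j) : ℝ) : ℂ))
      = character (-k) x * (f x * (cosSeries θ j x : ℂ)) := fun x => by
    rw [tsum_mul_left, tsum_mul_left, cosSeries, Complex.ofReal_tsum]
  simp only [e1, e2] at h
  exact h

/-- The frequency `2^{Q+1} e_i + e_j`. -/
def testFreq (i j : Fin n) (Q : ℕ) : Fin n → ℤ := Pi.single i (2 ^ (Q + 1)) + Pi.single j 1

theorem testFreq_left {i j : Fin n} (hij : i ≠ j) (Q : ℕ) : testFreq i j Q i = 2 ^ (Q + 1) := by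
  simp [testFreq, hij]

theorem testFreq_right {i j : Fin n} (hij : i ≠ j) (Q : ℕ) : testFreq i j Q j = 1 := by
  simp [testFreq, hij.symm]

theorem le_norm_latticeVec {k : Fin n → ℤ} {j : Fin n} {m : ℕ} (h : (2 : ℤ) ^ m ≤ |k j|) :
    (2 : ℝ) ^ m ≤ ‖latticeVec k‖ :=
  le_trans (by exact_mod_cast h) (abs_le_norm_latticeVec k j)

theorem le_norm_testFreq {i j : Fin n} (hij : i ≠ j) (Q : ℕ) :
    (2 : ℝ) ^ (Q + 1) ≤ ‖latticeVec (testFreq i j Q)‖ :=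
  le_norm_latticeVec (j := i) (by rw [testFreq_left hij]; exact le_abs_self _)

/-! ### Cross terms between the perturbation and the initial field -/

section CrossTerms

variable {ρ A θ : ℝ} {f : Torus n → ℂ} {i j : Fin n}

theorem IsCutoff.norm_coeff_mul_circleCos_le (hχ : IsCutoff χ)
    (hfi : Integrable f) (hf : BlockBound χ ρ A θ f) (hA : 0 ≤ A) (h0 : 0 ≤ θ) (hθ : θ < 1)
    (h1 : 1 ≤ ρ) (hij : i ≠ j) (Q : ℕ) :
    ‖coeff (fun x => f x * (circleCos (x j) : ℂ)) (testFreq i j Q)‖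
      ≤ A * (θ ^ Q / (1 - θ)) := by
  have h := coeff_mul_circleCos hfi 1 j (testFreq i j Q)
  simp only [one_smul] at h
  rw [h, norm_div, Complex.norm_ofNat, div_le_iff₀ two_pos, mul_two]
  have hb : ∀ l : Fin n → ℤ, l i = 2 ^ (Q + 1) → ‖coeff f l‖ ≤ A * (θ ^ Q / (1 - θ)) :=
    fun l hl => hχ.norm_coeff_le_of_blockBound hfi hf hA h0 hθ h1
      (le_norm_latticeVec (j := i) (by
        rw [hl]
        exact (pow_le_pow_right₀ (by norm_num) Q.le_succ).trans (le_abs_self _)))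
  refine (norm_add_le _ _).trans (add_le_add (hb _ ?_) (hb _ ?_)) <;>
    simp [testFreq_left hij, hij]

/-- Each mode `q` gains `θ^Q` from one of two sources. If `q ≤ Q`, the shifted frequency still has
`i`-coordinate at least `2^(Q+1) - 2^q ≥ 2^Q`, so the coefficient of `f` is small. If `q > Q`, the
weight `θ^q` is small; the shifted frequency may be low, but its `j`-coordinate is `1`, so the decay
bound at level `0` applies. -/
theorem IsCutoff.norm_coeff_mul_cosSeries_le (hχ : IsCutoff χ)
    (hfi : Integrable f) (hf : BlockBound χ ρ A θ f) (hA : 0 ≤ A) (h0 : 0 ≤ θ) (hθ : θ < 1)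
    (h1 : 1 ≤ ρ) (hij : i ≠ j) (Q : ℕ) :
    ‖coeff (fun x => f x * (cosSeries θ i x : ℂ)) (testFreq i j Q)‖
      ≤ 2 * A * θ ^ Q / (1 - θ) ^ 2 := by
  have hθ0 : 0 < 1 - θ := by linarith
  have h := hasSum_coeff_mul_cosSeries hfi h0 hθ i (testFreq i j Q)
  set k := testFreq i j Q with hk
  have hki : k i = 2 ^ (Q + 1) := testFreq_left hij Q
  have hkj : k j = 1 := testFreq_right hij Q
  have hone : ∀ l : Fin n → ℤ, l j = 1 → ‖coeff f l‖ ≤ A * (1 / (1 - θ)) := fun l hl => by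
    simpa using hχ.norm_coeff_le_of_blockBound hfi hf hA h0 hθ h1 (Q := 0)
      (le_norm_latticeVec (j := j) (by rw [hl]; simp))
  have hhigh : ∀ l : Fin n → ℤ, 2 ^ Q ≤ |l i| → ‖coeff f l‖ ≤ A * (θ ^ Q / (1 - θ)) :=
    fun l hl => hχ.norm_coeff_le_of_blockBound hfi hf hA h0 hθ h1
      (le_norm_latticeVec (j := i) hl)
  set t : ℕ → ℝ := fun q => if q < Q + 1 then A / (1 - θ) * θ ^ Q * θ ^ q
    else A / (1 - θ) * θ ^ q with ht
  have hbound : ∀ q : ℕ, ‖(θ ^ q : ℂ) * ((coeff f (k - Pi.single i ((2 ^ q : ℕ) : ℤ))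
        + coeff f (k + Pi.single i ((2 ^ q : ℕ) : ℤ))) / 2)‖ ≤ t q := fun q => by
    have hθq : ‖(θ ^ q : ℂ)‖ = θ ^ q := by
      rw [norm_pow, Complex.norm_real, Real.norm_of_nonneg h0]
    rw [norm_mul, hθq, norm_div, Complex.norm_ofNat]
    have hc : ∀ c, ‖coeff f (k - Pi.single i ((2 ^ q : ℕ) : ℤ))‖ ≤ c →
        ‖coeff f (k + Pi.single i ((2 ^ q : ℕ) : ℤ))‖ ≤ c →
        θ ^ q * (‖coeff f (k - Pi.single i ((2 ^ q : ℕ) : ℤ))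
          + coeff f (k + Pi.single i ((2 ^ q : ℕ) : ℤ))‖ / 2) ≤ θ ^ q * c := fun c h1 h2 => by
      have h3 := norm_add_le (coeff f (k - Pi.single i ((2 ^ q : ℕ) : ℤ)))
        (coeff f (k + Pi.single i ((2 ^ q : ℕ) : ℤ)))
      gcongr
      linarith
    simp only [ht]
    split_ifs with hq
    · refine (hc (A * (θ ^ Q / (1 - θ))) (hhigh _ ?_) (hhigh _ ?_)).trans_eq (by ring)
      · have h4 : (2 : ℤ) ^ q ≤ 2 ^ Q := pow_le_pow_right₀ (by norm_num) (by omega)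
        simp only [Pi.sub_apply, hki, Pi.single_eq_same, pow_succ]
        push_cast
        exact le_trans (by linarith) (le_abs_self _)
      · have h4 : (0 : ℤ) ≤ 2 ^ q := by positivity
        have h5 : (0 : ℤ) ≤ 2 ^ Q := by positivity
        simp only [Pi.add_apply, hki, Pi.single_eq_same, pow_succ]
        push_cast
        exact le_trans (by linarith) (le_abs_self _)
    · refine (hc (A * (1 / (1 - θ))) (hone _ ?_) (hone _ ?_)).trans_eq (by ring) <;>
        simp [hkj, hij.symm]
  have hgeo := summable_geometric_of_lt_one h0 hθ
  have htail : HasSum (fun q => t (q + (Q + 1))) (A / (1 - θ) * θ ^ (Q + 1) * (1 - θ)⁻¹) := by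
    have := (hasSum_geometric_of_lt_one h0 hθ).mul_left (A / (1 - θ) * θ ^ (Q + 1))
    refine this.congr_fun fun q => ?_
    simp only [ht]
    rw [if_neg (by omega), pow_add]
    ring
  have hts : HasSum t (A / (1 - θ) * θ ^ (Q + 1) * (1 - θ)⁻¹ + ∑ q ∈ Finset.range (Q + 1), t q) :=
    (hasSum_nat_add_iff (Q + 1)).1 htail
  have hfin : ∑ q ∈ Finset.range (Q + 1), t q ≤ A / (1 - θ) * θ ^ Q * (1 - θ)⁻¹ := by
    rw [Finset.sum_congr rfl fun q hq => (by
      simp only [ht]; rw [if_pos (Finset.mem_range.1 hq)] :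
        t q = A / (1 - θ) * θ ^ Q * θ ^ q), ← Finset.mul_sum]
    gcongr
    rw [← tsum_geometric_of_lt_one h0 hθ]
    exact hgeo.sum_le_tsum _ fun q _ => by positivity
  rw [← h.tsum_eq]
  refine (tsum_of_norm_bounded hts hbound).trans ?_
  have hpow : θ ^ (Q + 1) ≤ θ ^ Q := pow_le_pow_of_le_one h0 hθ.le Q.le_succ
  calc _ ≤ A / (1 - θ) * θ ^ Q * (1 - θ)⁻¹ + A / (1 - θ) * θ ^ Q * (1 - θ)⁻¹ := by gcongr
    _ = _ := by field_simp; ring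

end CrossTerms

/-! ### Exact quadratic coefficients of the initial field -/

section MainTerms

variable {i j : Fin n}

/-- The square does not depend on `x_i`, while a shift by `π / 2^(Q+1)` along `x_i` changes the sign
of the character. -/
theorem coeff_circleCos_mul_circleCos (hij : i ≠ j) (Q : ℕ) :
    coeff (fun x => (circleCos (x j) : ℂ) * (circleCos (x j) : ℂ)) (testFreq i j Q) = 0 := by
  rw [coeff, mul_eq_zero]
  right
  refine integral_eq_zero_of_translate
    (Pi.single i ((π / 2 ^ (Q + 1) : ℝ) : AddCircle (2 * π))) (c := -1) (by norm_num) fun x => ?_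
  rw [character_translate, character_neg _ (Pi.single i _), character_single, testFreq_left hij]
  push_cast
  rw [mul_div_cancel₀ _ (pow_ne_zero _ two_ne_zero), Complex.exp_pi_mul_I]
  simp [hij.symm]

theorem coeff_cosSeries_mul_cosSeries (θ : ℝ) (hij : i ≠ j) (Q : ℕ) :
    coeff (fun x => (cosSeries θ i x : ℂ) * (cosSeries θ i x : ℂ)) (testFreq i j Q) = 0 := by
  rw [coeff, mul_eq_zero]
  right
  refine integral_eq_zero_of_translate
    (Pi.single j ((π : ℝ) : AddCircle (2 * π))) (c := -1) (by norm_num) fun x => ?_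
  rw [character_translate, character_neg _ (Pi.single j _), character_single, testFreq_right hij]
  push_cast
  rw [one_mul, Complex.exp_pi_mul_I]
  simp [hij, cosSeries]

theorem memLp_ofReal_of_continuous {f : Torus n → ℝ} (hf : Continuous f) (p : ℝ≥0∞) :
    MemLp (fun x => (f x : ℂ)) p :=
  have hc : Continuous fun x => (f x : ℂ) := Complex.continuous_ofReal.comp hf
  memLp_of_continuous hc hc.aestronglyMeasurable p

theorem continuous_circleCos_apply (j : Fin n) : Continuous fun x : Torus n => circleCos (x j) :=
  continuous_circleCos.comp (continuous_apply j)

theorem coeff_circleCos (j : Fin n) (k : Fin n → ℤ) :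
    coeff (fun x => (circleCos (x j) : ℂ)) k
      = ((if k = Pi.single j 1 then 1 else 0) + if k = -Pi.single j 1 then 1 else 0) / 2 := by
  have h := coeff_mul_circleCos (integrable_character (0 : Fin n → ℤ)) 1 j k
  simp only [one_smul, character_zero, one_mul, coeff_character, sub_eq_zero, Nat.cast_one,
    add_eq_zero_iff_eq_neg] at h
  exact h

/-- The test frequency is a sum of a frequency of `cos x_j` and one of the series only for `q = Q +
1` and both signs positive; each cosine contributes a factor `1/2`. -/
theorem coeff_circleCos_mul_cosSeries {θ : ℝ} (h0 : 0 ≤ θ) (hθ : θ < 1) (hij : i ≠ j) (Q : ℕ) :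
    coeff (fun x => (circleCos (x j) : ℂ) * (cosSeries θ i x : ℂ)) (testFreq i j Q)
      = (θ ^ (Q + 1) / 4 : ℝ) := by
  have h := hasSum_coeff_mul_cosSeries (memLp_one_iff_integrable.1
    (memLp_ofReal_of_continuous (continuous_circleCos_apply j) 1)) h0 hθ i (testFreq i j Q)
  refine h.unique ?_
  have hki := testFreq_left hij Q
  have hkj := testFreq_right hij Q
  have h2 : (θ ^ (Q + 1) : ℂ) * ((coeff (fun x => (circleCos (x j) : ℂ))
        (testFreq i j Q - Pi.single i ((2 ^ (Q + 1) : ℕ) : ℤ))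
      + coeff (fun x => (circleCos (x j) : ℂ))
        (testFreq i j Q + Pi.single i ((2 ^ (Q + 1) : ℕ) : ℤ))) / 2)
      = (θ ^ (Q + 1) / 4 : ℝ) := by
    have e1 : testFreq i j Q - Pi.single i ((2 ^ (Q + 1) : ℕ) : ℤ) = Pi.single j 1 := by
      rw [testFreq]; push_cast; abel
    have e2 : testFreq i j Q + Pi.single i ((2 ^ (Q + 1) : ℕ) : ℤ) ≠ Pi.single j 1 := fun h => by
      have := congrFun h i
      have h3 : (0 : ℤ) < 2 ^ (Q + 1) := by positivity
      simp [hki, hij] at this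
    have e3 : testFreq i j Q + Pi.single i ((2 ^ (Q + 1) : ℕ) : ℤ) ≠ -Pi.single j 1 := fun h => by
      have := congrFun h j
      simp [hkj, hij.symm] at this
    have e4 : (Pi.single j 1 : Fin n → ℤ) ≠ -Pi.single j 1 := fun h => by
      have := congrFun h j
      simp at this
    rw [coeff_circleCos, coeff_circleCos, e1, if_pos rfl, if_neg e2, if_neg e3, if_neg e4]
    push_cast
    ring
  rw [← h2]
  refine hasSum_single (Q + 1) fun q hq => ?_
  have e1 : ∀ c : ℤ, testFreq i j Q - Pi.single i ((2 ^ q : ℕ) : ℤ) ≠ Pi.single j c :=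
      fun c h => by
    have := congrFun h i
    simp [hki, hij, sub_eq_zero] at this
    exact hq this.symm
  have e2 : ∀ c : ℤ, testFreq i j Q + Pi.single i ((2 ^ q : ℕ) : ℤ) ≠ Pi.single j c := fun c h => by
    have := congrFun h i
    have h3 : (0 : ℤ) < 2 ^ (Q + 1) := by positivity
    have h4 : (0 : ℤ) < 2 ^ q := by positivity
    simp [hki, hij] at this
    omega
  rw [coeff_circleCos, coeff_circleCos, ← Pi.single_neg, if_neg (e1 1),
    if_neg (e1 (-1)), if_neg (e2 1), if_neg (e2 (-1))]
  simp

end MainTerms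

/-! ### Quadratic Fourier coefficients of perturbations of the initial field -/

/-- A component of a vector field, as a complex function. -/
def component (u : Torus n → Vec n) (j : Fin n) (x : Torus n) : ℂ := (u x j : ℂ)

theorem coeff_add {f g : Torus n → ℂ} (hf : Integrable f) (hg : Integrable g) (k : Fin n → ℤ) :
    coeff (fun x => f x + g x) k = coeff f k + coeff g k := by
  simp only [coeff, mul_add]
  rw [integral_add (integrable_character_mul hf _) (integrable_character_mul hg _), mul_add]

theorem torusVolume_mul_coeff (f : Torus n → ℂ) (k : Fin n → ℤ) :
    torusVolume n * coeff f k = ∫ x, f x * character (-k) x := by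
  rw [coeff, mul_inv_cancel_left₀ torusVolume_ne_zero]
  simp only [mul_comm]

theorem norm_coeff_le_of_norm_integral_le {f : Torus n → ℂ} {k : Fin n → ℤ} {C : ℝ}
    (h : ‖∫ x, f x * character (-k) x‖ ≤ C) : ‖coeff f k‖ ≤ C := by
  have hV := one_le_torusVolume n
  rw [← torusVolume_mul_coeff, norm_mul, Complex.norm_real, Real.norm_of_nonneg (by linarith)] at h
  exact (le_mul_of_one_le_left (norm_nonneg _) hV).trans h

/-- The constant in the estimate of quadratic Fourier coefficients. -/
def productConst (n : ℕ) (ρ θ : ℝ) : ℝ :=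
  2 / ((1 - bernsteinConst n ρ * θ) * (1 - θ)) + 1 / (1 - √(bernsteinConst n ρ) * θ) ^ 2

/-- The size of the perturbation of quadratic Fourier coefficients. -/
def perturbationSize (n : ℕ) (ρ θ A : ℝ) : ℝ :=
  4 * A / (1 - θ) ^ 2 + productConst n ρ θ * A ^ 2

theorem IsCutoff.norm_coeff_perturbation_le (hχ : IsCutoff χ) {ρ A θ : ℝ}
    (hA : 0 ≤ A) (h0 : 0 ≤ θ) (hθ : θ < 1) (h1 : 1 ≤ ρ) (h2 : ρ ≤ 2)
    (hγ : bernsteinConst n ρ * θ < 1) {Q : ℕ} {k : Fin n → ℤ} (hk : 2 ^ (Q + 1) ≤ ‖latticeVec k‖)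
    {f g v w : Torus n → ℂ} (hf : MemLp f 2) (hg : MemLp g 2) (hv : MemLp v 2) (hw : MemLp w 2)
    (hvb : BlockBound χ ρ A θ v) (hwb : BlockBound χ ρ A θ w)
    (hvg : ‖coeff (fun x => v x * g x) k‖ ≤ 2 * A * θ ^ Q / (1 - θ) ^ 2)
    (hwf : ‖coeff (fun x => w x * f x) k‖ ≤ 2 * A * θ ^ Q / (1 - θ) ^ 2) :
    ‖coeff (fun x => (f x + v x) * (g x + w x)) k - coeff (fun x => f x * g x) k‖
      ≤ perturbationSize n ρ θ A * θ ^ Q := by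
  have hprod := norm_coeff_le_of_norm_integral_le
    (hχ.norm_integral_mul_mul_character_le hv hw hvb hwb hA h0 hθ h1 h2 hγ hk)
  have i1 := memLp_two_mul hf hg
  have i2 := memLp_two_mul hv hg
  have i3 := memLp_two_mul hw hf
  have i4 := memLp_two_mul hv hw
  have e : coeff (fun x => (f x + v x) * (g x + w x)) k
      = coeff (fun x => f x * g x) k + coeff (fun x => v x * g x) k
        + coeff (fun x => w x * f x) k + coeff (fun x => v x * w x) k := by
    rw [← coeff_add i1 i2, ← coeff_add (f := fun x => f x * g x + v x * g x) (i1.add i2) i3,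
      ← coeff_add (f := fun x => f x * g x + v x * g x + w x * f x) ((i1.add i2).add i3) i4]
    congr 1
    funext x
    ring
  rw [e, show ∀ a b c d : ℂ, a + b + c + d - a = b + c + d by intros; ring]
  refine norm_add₃_le.trans ((add_le_add_three hvg hwf hprod).trans_eq ?_)
  rw [perturbationSize, productConst]
  ring

theorem initialField_left (hn : 2 ≤ n) (s : ℝ) (x : Torus n) :
    initialField hn s x ⟨0, by omega⟩ = circleCos (x ⟨1, by omega⟩) := by
  simp [initialField]

theorem initialField_right (hn : 2 ≤ n) (s : ℝ) (x : Torus n) :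
    initialField hn s x ⟨1, by omega⟩ = cosSeries ((2 : ℝ) ^ (-s)) ⟨0, by omega⟩ x := by
  have h : ∀ q : ℕ, (2 : ℝ) ^ (-((q : ℝ) * s)) = ((2 : ℝ) ^ (-s)) ^ q := fun q => by
    rw [← Real.rpow_mul_natCast (by norm_num)]
    congr 1
    ring
  simp [initialField, cosSeries, h]

theorem initialField_other (hn : 2 ≤ n) (s : ℝ) (x : Torus n) {l : Fin n}
    (h0 : l ≠ ⟨0, by omega⟩) (h1 : l ≠ ⟨1, by omega⟩) : initialField hn s x l = 0 := by
  simp [initialField, h0, h1]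

theorem continuous_initialField (hn : 2 ≤ n) {s : ℝ} (hs : (2 : ℝ) ^ (-s) < 1) :
    Continuous (initialField hn s) := by
  have hc : ∀ l : Fin n, Continuous fun x => initialField hn s x l := fun l => by
    by_cases h0 : l = ⟨0, by omega⟩
    · subst h0
      simp only [initialField_left]
      exact continuous_circleCos_apply _
    by_cases h1 : l = ⟨1, by omega⟩
    · subst h1
      simp only [initialField_right]
      exact continuous_cosSeries (by positivity) hs _
    · simp only [initialField_other hn s _ h0 h1]
      exact continuous_const
  exact (PiLp.continuous_toLp 2 _).comp (continuous_pi hc)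

theorem memLp_component {u : Torus n → Vec n} (hu : MemLp u 2) (j : Fin n) :
    MemLp (component u j) 2 :=
  (Complex.ofRealCLM.comp (EuclideanSpace.proj j)).comp_memLp' hu

theorem memLp_initialField (hn : 2 ≤ n) {s : ℝ} (hs : (2 : ℝ) ^ (-s) < 1) :
    MemLp (initialField hn s) 2 :=
  have h := continuous_initialField hn hs
  memLp_of_continuous h h.aestronglyMeasurable 2

/-- The quadratic Fourier coefficients of a field close to the initial field. -/
theorem IsCutoff.norm_coeff_component_mul_le (hχ : IsCutoff χ) (hn : 2 ≤ n) {s ρ A : ℝ}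
    (hA : 0 ≤ A) (hθ : (2 : ℝ) ^ (-s) < 1) (h1 : 1 ≤ ρ) (h2 : ρ ≤ 2)
    (hγ : bernsteinConst n ρ * (2 : ℝ) ^ (-s) < 1) (Q : ℕ) {u : Torus n → Vec n}
    (hu : MemLp u 2)
    (hb : ∀ l, BlockBound χ ρ A ((2 : ℝ) ^ (-s)) (component (fun x => u x - initialField hn s x) l)) :
    ‖coeff (fun x => component u ⟨0, by omega⟩ x * component u ⟨0, by omega⟩ x)
        (testFreq ⟨0, by omega⟩ ⟨1, by omega⟩ Q)‖
      ≤ perturbationSize n ρ (2 ^ (-s)) A * ((2 : ℝ) ^ (-s)) ^ Q ∧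
    ‖coeff (fun x => component u ⟨0, by omega⟩ x * component u ⟨1, by omega⟩ x)
        (testFreq ⟨0, by omega⟩ ⟨1, by omega⟩ Q) - ((((2 : ℝ) ^ (-s)) ^ (Q + 1) / 4 : ℝ) : ℂ)‖
      ≤ perturbationSize n ρ (2 ^ (-s)) A * ((2 : ℝ) ^ (-s)) ^ Q ∧
    ‖coeff (fun x => component u ⟨1, by omega⟩ x * component u ⟨1, by omega⟩ x)
        (testFreq ⟨0, by omega⟩ ⟨1, by omega⟩ Q)‖
      ≤ perturbationSize n ρ (2 ^ (-s)) A * ((2 : ℝ) ^ (-s)) ^ Q := by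
  set i : Fin n := ⟨0, by omega⟩ with hi
  set j : Fin n := ⟨1, by omega⟩ with hj
  set θ : ℝ := (2 : ℝ) ^ (-s) with hθdef
  have h0 : 0 ≤ θ := by positivity
  have hij : i ≠ j := by simp [hi, hj]
  set w : Torus n → Vec n := fun x => u x - initialField hn s x with hw
  have hwm : MemLp w 2 := hu.sub (memLp_initialField hn hθ)
  have hwc : ∀ l, MemLp (component w l) 2 := memLp_component hwm
  have hk := le_norm_testFreq hij Q
  have hui : ∀ x, component u i x = circleCos (x j) + component w i x := fun x => by
    simp only [component, hw, PiLp.sub_apply, hi, initialField_left hn s x, ← hj]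
    push_cast
    ring
  have huj : ∀ x, component u j x = cosSeries θ i x + component w j x := fun x => by
    simp only [component, hw, PiLp.sub_apply, hj, initialField_right hn s x, ← hi, ← hθdef]
    push_cast
    ring
  have hc := memLp_ofReal_of_continuous (continuous_circleCos_apply j) 2
  have hg := memLp_ofReal_of_continuous (continuous_cosSeries h0 hθ i) 2
  have hθ0 : 0 < 1 - θ := by linarith
  have hwcb : ∀ l, ‖coeff (fun x => component w l x * (circleCos (x j) : ℂ)) (testFreq i j Q)‖
      ≤ 2 * A * θ ^ Q / (1 - θ) ^ 2 := fun l => by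
    refine (hχ.norm_coeff_mul_circleCos_le (integrable_of_memLp_two (hwc l)) (hb l) hA h0 hθ h1
      hij Q).trans ?_
    rw [← mul_div_assoc, div_le_div_iff₀ hθ0 (by positivity)]
    have : 0 ≤ A * θ ^ Q * (1 - θ) := by positivity
    nlinarith
  have hwgb : ∀ l, ‖coeff (fun x => component w l x * (cosSeries θ i x : ℂ)) (testFreq i j Q)‖
      ≤ 2 * A * θ ^ Q / (1 - θ) ^ 2 := fun l =>
    hχ.norm_coeff_mul_cosSeries_le (integrable_of_memLp_two (hwc l)) (hb l) hA h0 hθ h1 hij Q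
  simp only [hui, huj]
  refine ⟨?_, ?_, ?_⟩
  · have := hχ.norm_coeff_perturbation_le hA h0 hθ h1 h2 hγ hk hc hc (hwc i) (hwc i) (hb i) (hb i)
      (hwcb i) (hwcb i)
    rwa [coeff_circleCos_mul_circleCos hij, sub_zero] at this
  · have := hχ.norm_coeff_perturbation_le hA h0 hθ h1 h2 hγ hk hc hg (hwc i) (hwc j) (hb i) (hb j)
      (hwgb i) (hwcb j)
    rwa [coeff_circleCos_mul_cosSeries h0 hθ hij] at this
  · have := hχ.norm_coeff_perturbation_le hA h0 hθ h1 h2 hγ hk hg hg (hwc j) (hwc j) (hb j) (hb j)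
      (hwgb j) (hwgb j)
    rwa [coeff_cosSeries_mul_cosSeries θ hij, sub_zero] at this

/-! ### Block bounds from the Besov norm -/

/-- The finite measure embeds `L^r` into `L^(min r 2)` at the cost of at most the volume. The factor
`2^s` comes from the index shift `q = p - 1`. -/
theorem IsCutoff.blockBound_of_besovNorm_le (hχ : IsCutoff χ) {s δ : ℝ} {r : ℝ≥0∞} (hr : 1 ≤ r)
    (hδ : 0 ≤ δ) {w : Torus n → Vec n} (h : besovNorm χ s r w ≤ ENNReal.ofReal δ) (l : Fin n) :
    BlockBound χ (min r 2).toReal (torusVolume n * 2 ^ s * δ) ((2 : ℝ) ^ (-s))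
      (component w l) := by
  intro p
  have hV := one_le_torusVolume n
  have hfin : min r 2 ≠ ⊤ := ne_top_of_le_ne_top (by simp) (min_le_right r 2)
  have hone : 1 ≤ min r 2 := le_min hr one_le_two
  rw [ENNReal.ofReal_toReal hfin]
  have h1 := eLpNorm_le_eLpNorm_mul_rpow_measure_univ (μ := volume) (min_le_left r 2)
    (continuous_block (χ := χ) p (component w l)).aestronglyMeasurable
  rw [volume_univ_torus, ENNReal.ofReal_rpow_of_pos (torusVolume_pos n)] at h1
  have h2 : torusVolume n ^ (1 / (min r 2).toReal - 1 / r.toReal) ≤ torusVolume n := by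
    conv_rhs => rw [← Real.rpow_one (torusVolume n)]
    refine Real.rpow_le_rpow_of_exponent_le hV ?_
    have h3 : 1 ≤ (min r 2).toReal := by
      rw [← ENNReal.toReal_one]; exact ENNReal.toReal_mono hfin hone
    have h4 : 1 / (min r 2).toReal ≤ 1 := (div_le_one (by linarith)).2 h3
    -- For `r = ∞` this quotient is `1 / 0 = 0`, the correct value of `1/r`.
    have h5 : 0 ≤ 1 / r.toReal := by positivity
    linarith
  have h3 : eLpNorm (block χ p (component w l)) r volume
      ≤ eLpNorm (lpBlock χ w ((p : ℤ) - 1)) r volume := by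
    refine eLpNorm_mono fun x => ?_
    have := PiLp.norm_apply_le (lpBlock χ w ((p : ℤ) - 1) x) l
    rwa [hχ.lpBlock_apply] at this
  set c : ℝ := (2 : ℝ) ^ ((((p : ℤ) - 1 : ℤ) : ℝ) * s) with hc
  have hcpos : 0 < c := by positivity
  have h4 : ENNReal.ofReal c * eLpNorm (lpBlock χ w ((p : ℤ) - 1)) r volume
      ≤ ENNReal.ofReal δ :=
    (le_iSup₂ (f := fun (q : ℤ) (_ : q ∈ Set.Ici (-1 : ℤ)) =>
      ENNReal.ofReal ((2 : ℝ) ^ ((q : ℝ) * s)) * eLpNorm (lpBlock χ w q) r volume)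
      ((p : ℤ) - 1) (Set.mem_Ici.2 (by omega))).trans h
  have h5 : eLpNorm (lpBlock χ w ((p : ℤ) - 1)) r volume ≤ ENNReal.ofReal (δ / c) := by
    rw [ENNReal.ofReal_div_of_pos hcpos, ENNReal.le_div_iff_mul_le (by simp [hcpos]) (by simp),
      mul_comm]
    exact h4
  calc eLpNorm (block χ p (component w l)) (min r 2) volume
      ≤ ENNReal.ofReal (δ / c) * ENNReal.ofReal (torusVolume n) :=
        h1.trans (mul_le_mul' (h3.trans h5) (ENNReal.ofReal_le_ofReal h2))
    _ = ENNReal.ofReal (torusVolume n * 2 ^ s * δ * (2 ^ (-s)) ^ p) := by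
        rw [← ENNReal.ofReal_mul (by positivity)]
        congr 1
        have : c⁻¹ = 2 ^ s * (2 ^ (-s)) ^ p := by
          rw [hc, ← Real.rpow_neg two_pos.le, ← Real.rpow_mul_natCast two_pos.le,
            ← Real.rpow_add two_pos]
          congr 1
          push_cast
          ring
        rw [div_eq_mul_inv, this]
        ring

/-- Truncating `f` makes the convolution finite, and `L²` convergence passes to the limit. This
expresses quadratic coefficients through linear ones, the only ones that weak continuity in time
controls directly. -/
theorem coeff_mul_eq_tendsto (hχ : IsCutoff χ) {f g : Torus n → ℂ} (hf : MemLp f 2)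
    (hg : MemLp g 2) (k : Fin n → ℤ) :
    Tendsto (fun N => ∑ l ∈ box n N, lowPass χ N l * coeff f l * coeff g (k - l)) atTop
      (𝓝 (coeff (fun x => f x * g x) k)) := by
  have h1 : ∀ N, ∑ l ∈ box n N, lowPass χ N l * coeff f l * coeff g (k - l)
      = coeff (fun x => lowBlock χ N f x * g x) k := fun N => by
    have e : (fun x => lowBlock χ N f x * g x)
        = fun x => ∑ l ∈ box n N, (lowPass χ N l * coeff f l) * (character l x * g x) := by
      funext x
      simp only [lowBlock, trigPoly, Finset.sum_mul, mul_assoc]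
    rw [e, coeff_finset_sum _ fun l _ =>
      (integrable_character_mul (integrable_of_memLp_two hg) l).const_mul _]
    simp only [coeff_const_mul, coeff_character_mul]
  simp only [h1]
  rw [tendsto_iff_norm_sub_tendsto_zero]
  have hfin : eLpNorm g 2 volume ≠ ⊤ := hg.eLpNorm_ne_top
  have h2 : Tendsto (fun N => (eLpNorm (fun x => f x - lowBlock χ N f x) 2 volume
      * eLpNorm g 2 volume).toReal) atTop (𝓝 0) := by
    have := ENNReal.Tendsto.mul_const (hχ.tendsto_eLpNorm_sub_lowBlock hf)
      (b := eLpNorm g 2 volume) (Or.inr hfin)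
    rw [zero_mul] at this
    exact (ENNReal.tendsto_toReal ENNReal.zero_ne_top).comp this
  refine squeeze_zero (fun _ => norm_nonneg _) (fun N => ?_) h2
  have hd : MemLp (fun x => f x - lowBlock χ N f x) 2 := hf.sub (memLp_lowBlock N f 2)
  rw [norm_sub_rev, ← coeff_sub (memLp_two_mul hf hg) (memLp_two_mul (memLp_lowBlock N f 2) hg)]
  refine norm_coeff_le_of_norm_integral_le ?_
  rw [← toReal_enorm]
  refine ENNReal.toReal_mono (ENNReal.mul_ne_top hd.eLpNorm_ne_top hfin) ?_
  refine (enorm_integral_le_lintegral_enorm _).trans ((le_of_eq ?_).trans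
    (lintegral_enorm_mul_le hd.1 hg.1))
  refine lintegral_congr fun x => ?_
  rw [enorm_mul, enorm_character, mul_one, ← sub_mul, enorm_mul]

/-! ### Plane wave test fields -/

theorem character_toTorus_re (k : Fin n → ℤ) (y : Fin n → ℝ) :
    (character k (toTorus y)).re = Real.cos (∑ j, k j * y j) := by
  rw [character_toTorus, Complex.exp_ofReal_mul_I_re]

theorem character_toTorus_im (k : Fin n → ℤ) (y : Fin n → ℝ) :
    (character k (toTorus y)).im = Real.sin (∑ j, k j * y j) := by
  rw [character_toTorus, Complex.exp_ofReal_mul_I_im]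

theorem partialDeriv_character_im (c : ℝ) (k : Fin n → ℤ) (l : Fin n) (x : Torus n) :
    partialDeriv l (fun y => c * (character k y).im) x = c * (k l * (character k x).re) := by
  obtain ⟨y, rfl⟩ := toTorus_surjective x
  have h1 : ∀ h : ℝ, c * (character k (toTorus y + Pi.single l (h : AddCircle (2 * π)))).im
      = c * Real.sin (∑ j, k j * y j + k l * h) := fun h => by
    rw [← toTorus_single, ← toTorus_add, character_toTorus_im]
    congr 2
    simp only [Pi.add_apply, mul_add, Finset.sum_add_distrib]
    congr 1
    rw [Finset.sum_eq_single l]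
    · simp
    · intro i _ hi; simp [hi]
    · simp
  have h2 : HasDerivAt (fun h : ℝ => c * Real.sin (∑ j, k j * y j + k l * h))
      (c * (Real.cos (∑ j, k j * y j + k l * 0) * (k l * 1))) 0 :=
    ((((hasDerivAt_id (0 : ℝ)).const_mul (k l : ℝ)).const_add _).sin).const_mul c
  rw [partialDeriv]
  simp only [h1]
  rw [h2.deriv, character_toTorus_re, mul_zero, add_zero]
  ring

/-- The plane wave `η(t) sin(k·x) a`. -/
def planeWave (η : ℝ → ℝ) (a : Fin n → ℝ) (k : Fin n → ℤ) (t : ℝ) (x : Torus n) : Vec n :=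
  WithLp.toLp 2 fun m => η t * a m * (character k x).im

theorem planeWave_apply (η : ℝ → ℝ) (a : Fin n → ℝ) (k : Fin n → ℤ) (t : ℝ) (x : Torus n)
    (m : Fin n) : planeWave η a k t x m = η t * a m * (character k x).im := rfl

theorem partialDeriv_planeWave (η : ℝ → ℝ) (a : Fin n → ℝ) (k : Fin n → ℤ) (t : ℝ) (x : Torus n)
    (l m : Fin n) : partialDeriv l (fun y => planeWave η a k t y m) x
      = η t * a m * (k l * (character k x).re) :=
  partialDeriv_character_im _ k l x

theorem deriv_planeWave {η : ℝ → ℝ} (hη : Differentiable ℝ η) (a : Fin n → ℝ) (k : Fin n → ℤ)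
    (t : ℝ) (x : Torus n) (m : Fin n) :
    deriv (fun τ => planeWave η a k τ x m) t = deriv η t * a m * (character k x).im := by
  simp only [planeWave_apply, mul_assoc]
  exact ((hη t).hasDerivAt.mul_const _).deriv

theorem isTestField_planeWave {η : ℝ → ℝ} (hη : ContDiff ℝ ∞ η) {a : Fin n → ℝ} {k : Fin n → ℤ}
    (hak : ∑ m, k m * a m = 0) {T b c : ℝ} (hb : 0 < b) (hc : c < T)
    (hsupp : ∀ t, t ∉ Set.Icc b c → η t = 0) : IsTestField T (planeWave η a k) where
  smooth := by
    refine contDiff_euclidean.2 fun m => ?_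
    simp only [planeWave_apply, character_toTorus_im]
    fun_prop
  support := ⟨b, c, hb, hc, fun t ht x => by
    ext m
    simp [planeWave_apply, hsupp t ht]⟩
  divFree := fun t x => by
    simp only [partialDeriv_planeWave]
    calc _ = η t * (character k x).re * ∑ m, k m * a m := by
          rw [Finset.mul_sum]
          exact Finset.sum_congr rfl fun m _ => by ring
      _ = 0 := by rw [hak, mul_zero]

theorem torusVolume_mul_coeff_ofReal {f : Torus n → ℝ} (hf : Integrable fun x => (f x : ℂ))
    (k : Fin n → ℤ) :
    torusVolume n * (coeff (fun x => (f x : ℂ)) k).re = ∫ x, f x * (character k x).re ∧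
    -(torusVolume n * (coeff (fun x => (f x : ℂ)) k).im) = ∫ x, f x * (character k x).im := by
  have h := torusVolume_mul_coeff (fun x => (f x : ℂ)) k
  have hi := integrable_mul_character hf (-k)
  constructor
  · rw [← Complex.re_ofReal_mul, h]
    refine (Complex.reCLM.integral_comp_comm hi).symm.trans ?_
    simp [character_neg]
  · rw [← Complex.im_ofReal_mul, h, neg_eq_iff_eq_neg, ← integral_neg]
    refine (Complex.imCLM.integral_comp_comm hi).symm.trans ?_
    simp [character_neg]

/-! ### Testing a weak solution with plane waves -/

/-- The linear functional of the weak formulation. -/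
def waveMomentum (a : Fin n → ℝ) (k : Fin n → ℤ) (u : Torus n → Vec n) : ℝ :=
  -(torusVolume n * ∑ m, a m * (coeff (component u m) k).im)

/-- The quadratic functional of the weak formulation. -/
def waveStress (a : Fin n → ℝ) (k : Fin n → ℤ) (u : Torus n → Vec n) : ℝ :=
  torusVolume n * ∑ l, (k l : ℝ) * ∑ m,
    a m * (coeff (fun x => component u l x * component u m x) k).re

/-- Reduces the weak equation to the scalar law `F' = G` in the sense of distributions, with `F` the
momentum and `G` the stress at frequency `k`. -/
theorem integral_planeWave {η : ℝ → ℝ} (hη : Differentiable ℝ η) (a : Fin n → ℝ) (k : Fin n → ℤ)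
    {u : Torus n → Vec n} (hu : MemLp u 2) (t : ℝ) :
    ∫ x, (∑ j, u x j * deriv (fun τ => planeWave η a k τ x j) t
        + ∑ i, ∑ j, u x i * u x j * partialDeriv i (fun y => planeWave η a k t y j) x)
      = deriv η t * waveMomentum a k u + η t * waveStress a k u := by
  have hc := memLp_component hu
  have hci : ∀ m, Integrable (fun x => (u x m : ℂ)) := fun m => integrable_of_memLp_two (hc m)
  have hcc : ∀ l m, Integrable (fun x => ((u x l * u x m : ℝ) : ℂ)) := fun l m => by
    simp only [Complex.ofReal_mul]
    exact memLp_two_mul (hc l) (hc m)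
  have hr : ∀ {f : Torus n → ℝ}, Integrable (fun x => (f x : ℂ)) →
      Integrable (fun x => f x * (character k x).re) ∧
      Integrable (fun x => f x * (character k x).im) := fun {f} hf => by
    have hf' : Integrable f := hf.re
    refine ⟨hf'.mul_bdd (c := 1)
      (Complex.continuous_re.comp (continuous_character k)).aestronglyMeasurable ?_,
      hf'.mul_bdd (c := 1)
      (Complex.continuous_im.comp (continuous_character k)).aestronglyMeasurable ?_⟩
    · exact Eventually.of_forall fun x => (Complex.abs_re_le_norm _).trans (norm_character k x).le
    · exact Eventually.of_forall fun x => (Complex.abs_im_le_norm _).trans (norm_character k x).le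
  simp only [deriv_planeWave hη, partialDeriv_planeWave]
  have e1 : ∀ x, ∑ j, u x j * (deriv η t * a j * (character k x).im)
      = ∑ j, deriv η t * a j * (u x j * (character k x).im) := fun x =>
    Finset.sum_congr rfl fun j _ => by ring
  have e2 : ∀ x, ∑ i, ∑ j, u x i * u x j * (η t * a j * (k i * (character k x).re))
      = ∑ i, ∑ j, η t * k i * a j * (u x i * u x j * (character k x).re) := fun x =>
    Finset.sum_congr rfl fun i _ => Finset.sum_congr rfl fun j _ => by ring
  simp only [e1, e2]
  have i1 : ∀ j, Integrable fun x => deriv η t * a j * (u x j * (character k x).im) :=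
    fun j => (hr (hci j)).2.const_mul _
  have i2 : ∀ i j, Integrable fun x =>
      η t * k i * a j * (u x i * u x j * (character k x).re) :=
    fun i j => (hr (hcc i j)).1.const_mul _
  rw [integral_add (integrable_finsetSum _ fun j _ => i1 j)
    (integrable_finsetSum _ fun i _ => integrable_finsetSum _ fun j _ => i2 i j),
    integral_finsetSum _ fun j _ => i1 j,
    integral_finsetSum _ fun i _ => integrable_finsetSum _ fun j _ => i2 i j]
  simp only [integral_finsetSum _ fun j _ => i2 _ j, integral_const_mul,
    ← (torusVolume_mul_coeff_ofReal (hci _) k).2, ← (torusVolume_mul_coeff_ofReal (hcc _ _) k).1]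
  congr 1
  · rw [waveMomentum, Finset.mul_sum, ← Finset.sum_neg_distrib, Finset.mul_sum]
    refine Finset.sum_congr rfl fun m _ => ?_
    unfold component
    ring
  · rw [waveStress, Finset.mul_sum, Finset.mul_sum]
    refine Finset.sum_congr rfl fun l _ => ?_
    rw [Finset.mul_sum, Finset.mul_sum, Finset.mul_sum]
    refine Finset.sum_congr rfl fun m _ => ?_
    simp only [component, Complex.ofReal_mul]
    ring

/-! ### Continuity and measurability in time -/

theorem continuousOn_integral_mul {S : Set ℝ} {u : ℝ → L2Field n}
    (hu : ∀ g : L2Field n, ContinuousOn (fun t => inner ℝ g (u t)) S) {h : Torus n → ℝ}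
    (hh : Continuous h) (m : Fin n) : ContinuousOn (fun t => ∫ x, u t x m * h x) S := by
  have hc : Continuous fun x => h x • EuclideanSpace.single m (1 : ℝ) := hh.smul continuous_const
  have hm := memLp_of_continuous hc hc.aestronglyMeasurable 2
  refine (hu (hm.toLp _)).congr fun t _ => ?_
  beta_reduce
  rw [L2.inner_def]
  refine integral_congr_ae ?_
  filter_upwards [hm.coeFn_toLp] with x hx
  rw [hx, real_inner_smul_left, EuclideanSpace.inner_single_left]
  simp [mul_comm]

theorem continuousOn_coeff {S : Set ℝ} {u : ℝ → L2Field n}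
    (hu : ∀ g : L2Field n, ContinuousOn (fun t => inner ℝ g (u t)) S) (m : Fin n)
    (k : Fin n → ℤ) : ContinuousOn (fun t => coeff (component (u t) m) k) S := by
  have hV := torusVolume_pos n
  have hi : ∀ t, Integrable fun x => (u t x m : ℂ) := fun t =>
    integrable_of_memLp_two (memLp_component (Lp.memLp (u t)) m)
  have e : ∀ t, coeff (component (u t) m) k = (torusVolume n : ℂ)⁻¹ *
      (((∫ x, u t x m * (character k x).re : ℝ) : ℂ)
        - ((∫ x, u t x m * (character k x).im : ℝ) : ℂ) * Complex.I) := fun t => by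
    have h := torusVolume_mul_coeff_ofReal (hi t) k
    rw [← h.1, ← h.2, eq_inv_mul_iff_mul_eq₀ torusVolume_ne_zero]
    change (torusVolume n : ℂ) * coeff (fun x => (u t x m : ℂ)) k = _
    apply Complex.ext <;> simp
  simp only [e]
  have h1 := continuousOn_integral_mul hu
    (Complex.continuous_re.comp (continuous_character k)) m
  have h2 := continuousOn_integral_mul hu
    (Complex.continuous_im.comp (continuous_character k)) m
  exact continuousOn_const.mul ((Complex.continuous_ofReal.comp_continuousOn h1).sub
    ((Complex.continuous_ofReal.comp_continuousOn h2).mul continuousOn_const))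

theorem IsCutoff.aestronglyMeasurable_coeff_mul (hχ : IsCutoff χ) {S : Set ℝ}
    (hS : MeasurableSet S) {u : ℝ → L2Field n}
    (hu : ∀ g : L2Field n, ContinuousOn (fun t => inner ℝ g (u t)) S) (l m : Fin n)
    (k : Fin n → ℤ) :
    AEStronglyMeasurable (fun t => coeff (fun x => component (u t) l x * component (u t) m x) k)
      (volume.restrict S) := by
  refine aestronglyMeasurable_of_tendsto_ae atTop
    (f := fun N t => ∑ κ ∈ box n N, lowPass χ N κ * coeff (component (u t) l) κ
      * coeff (component (u t) m) (k - κ)) (fun N => ?_) ?_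
  · refine ContinuousOn.aestronglyMeasurable ?_ hS
    exact continuousOn_finsetSum _ fun κ _ => (continuousOn_const.mul
      (continuousOn_coeff hu l κ)).mul (continuousOn_coeff hu m (k - κ))
  · exact Eventually.of_forall fun t => coeff_mul_eq_tendsto hχ
      (memLp_component (Lp.memLp (u t)) l) (memLp_component (Lp.memLp (u t)) m) k

/-- Testing `F' = G` against a bump function, when `F` is nearly constant and `G` is large. -/
theorem mul_integral_le_of_integral_eq_zero {T b c : ℝ} (hT : 0 < T) (hb : 0 < b) (hc : c < T)
    {η : ℝ → ℝ} (hη : ContDiff ℝ ∞ η) (hη0 : ∀ t, 0 ≤ η t)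
    (hsupp : ∀ t, t ∉ Set.Icc b c → η t = 0) {F G : ℝ → ℝ}
    (hF : AEStronglyMeasurable F (volume.restrict (Set.Ioo 0 T)))
    (hG : AEStronglyMeasurable G (volume.restrict (Set.Ioo 0 T)))
    (h : ∫ t in Set.Ioo 0 T, (deriv η t * F t + η t * G t) = 0) {f κ m M : ℝ}
    (hFb : ∀ t ∈ Set.Icc b c, |F t - f| ≤ κ)
    (hGm : ∀ t ∈ Set.Icc b c, m ≤ G t) (hGM : ∀ t ∈ Set.Icc b c, G t ≤ M) :
    m * ∫ t in Set.Ioo 0 T, η t ≤ κ * ∫ t in Set.Ioo 0 T, |deriv η t| := by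
  have hsupp' : ∀ t, t ∉ Set.Icc b c → deriv η t = 0 := fun t ht => by
    have : η =ᶠ[𝓝 t] fun _ => 0 := by
      filter_upwards [isClosed_Icc.isOpen_compl.mem_nhds ht] with τ hτ using hsupp τ hτ
    rw [this.deriv_eq, deriv_const]
  have hcη : Continuous η := hη.continuous
  have hcd : Continuous (deriv η) := hη.continuous_deriv (by simp)
  have hint : ∀ {g : ℝ → ℝ}, Continuous g → IntegrableOn g (Set.Ioo 0 T) := fun hg =>
    hg.integrableOn_Icc.mono_set Set.Ioo_subset_Icc_self
  -- Allows the constant `f` to be subtracted from `F`, so that only the deviation `κ` counts.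
  have hd0 : ∫ t in Set.Ioo 0 T, deriv η t = 0 := by
    rw [← integral_Ioc_eq_integral_Ioo, ← intervalIntegral.integral_of_le hT.le,
      intervalIntegral.integral_deriv_eq_sub (fun t _ => (hη.differentiable (by simp)) t)
        (hcd.intervalIntegrable _ _), hsupp T (fun h => by linarith [h.2]),
      hsupp 0 (fun h => by linarith [h.1]), sub_zero]
  have i1 : IntegrableOn (fun t => deriv η t * (F t - f)) (Set.Ioo 0 T) := by
    refine Integrable.mono' (((hint hcd).norm).mul_const κ)
      (hcd.aestronglyMeasurable.mul (hF.sub aestronglyMeasurable_const)) ?_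
    refine Eventually.of_forall fun t => ?_
    by_cases ht : t ∈ Set.Icc b c
    · rw [norm_mul]
      exact mul_le_mul_of_nonneg_left (hFb t ht) (norm_nonneg _)
    · simp [hsupp' t ht]
  -- The upper bound `M` matters for integrability only; it does not enter the conclusion.
  have i2 : IntegrableOn (fun t => η t * G t) (Set.Ioo 0 T) := by
    refine Integrable.mono' ((hint hcη).mul_const (max |m| |M|))
      (hcη.aestronglyMeasurable.mul hG) ?_
    refine Eventually.of_forall fun t => ?_
    by_cases ht : t ∈ Set.Icc b c
    · rw [norm_mul, Real.norm_of_nonneg (hη0 t)]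
      exact mul_le_mul_of_nonneg_left (abs_le_max_abs_abs (hGm t ht) (hGM t ht)) (hη0 t)
    · simp [hsupp t ht]
  have h2 : (∫ t in Set.Ioo 0 T, deriv η t * (F t - f)) + ∫ t in Set.Ioo 0 T, η t * G t = 0 := by
    refine (integral_add i1 i2).symm.trans (Eq.trans ?_ h)
    have e : ∀ t, deriv η t * F t + η t * G t
        = (deriv η t * (F t - f) + η t * G t) + f * deriv η t := fun t => by ring
    simp only [e]
    have i12 : IntegrableOn (fun t => deriv η t * (F t - f) + η t * G t) (Set.Ioo 0 T) := i1.add i2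
    rw [integral_add i12 ((hint hcd).const_mul f), integral_const_mul, hd0, mul_zero, add_zero]
  have h3 : m * ∫ t in Set.Ioo 0 T, η t ≤ ∫ t in Set.Ioo 0 T, η t * G t := by
    rw [← integral_const_mul]
    refine integral_mono ((hint hcη).const_mul m) i2 fun t => ?_
    by_cases ht : t ∈ Set.Icc b c
    · change m * η t ≤ η t * G t
      rw [mul_comm]
      exact mul_le_mul_of_nonneg_left (hGm t ht) (hη0 t)
    · simp [hsupp t ht]
  have h4 : -(κ * ∫ t in Set.Ioo 0 T, |deriv η t|)
      ≤ ∫ t in Set.Ioo 0 T, deriv η t * (F t - f) := by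
    rw [← integral_const_mul, ← integral_neg]
    refine integral_mono ((hint hcd.abs).const_mul κ).neg i1 fun t => ?_
    by_cases ht : t ∈ Set.Icc b c
    · change -(κ * |deriv η t|) ≤ deriv η t * (F t - f)
      refine neg_le_of_abs_le ?_
      rw [abs_mul, mul_comm κ]
      exact mul_le_mul_of_nonneg_left (hFb t ht) (abs_nonneg _)
    · simp [hsupp' t ht]
  linarith

/-! ### Growth of the momentum at the test frequencies -/

/-- An amplitude orthogonal to `testFreq i j Q`. -/
def testAmplitude (i j : Fin n) (Q : ℕ) : Fin n → ℝ :=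
  Pi.single i (-((2 : ℝ) ^ (Q + 1))⁻¹) + Pi.single j 1

theorem sum_testFreq_mul (i j : Fin n) (Q : ℕ) (X : Fin n → ℝ) :
    ∑ l, (testFreq i j Q l : ℝ) * X l = 2 ^ (Q + 1) * X i + X j := by
  simp [testFreq, add_mul, Finset.sum_add_distrib, Pi.single_apply, ite_mul, Int.cast_ite]

theorem sum_testAmplitude_mul (i j : Fin n) (Q : ℕ) (X : Fin n → ℝ) :
    ∑ l, testAmplitude i j Q l * X l = -((2 : ℝ) ^ (Q + 1))⁻¹ * X i + X j := by
  simp [testAmplitude, add_mul, Finset.sum_add_distrib, Pi.single_apply, ite_mul]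

theorem sum_testFreq_mul_testAmplitude {i j : Fin n} (hij : i ≠ j) (Q : ℕ) :
    ∑ l, (testFreq i j Q l : ℝ) * testAmplitude i j Q l = 0 := by
  rw [sum_testFreq_mul]
  simp [testAmplitude, hij, hij.symm]

/-- With `L = 2^(Q+1)`, `k = (L, 1)` and `a = (-L⁻¹, 1)` in the coordinates `i`, `j`: the diagonal
weights are `∓1`, and only the mixed coefficient is amplified by `L`. -/
theorem waveStress_testFreq (i j : Fin n) (Q : ℕ) (u : Torus n → Vec n) :
    waveStress (testAmplitude i j Q) (testFreq i j Q) u = torusVolume n *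
      (-(coeff (fun x => component u i x * component u i x) (testFreq i j Q)).re
        + (coeff (fun x => component u j x * component u j x) (testFreq i j Q)).re
        + (2 ^ (Q + 1) - (2 ^ (Q + 1))⁻¹)
          * (coeff (fun x => component u i x * component u j x) (testFreq i j Q)).re) := by
  rw [waveStress, sum_testFreq_mul, sum_testAmplitude_mul, sum_testAmplitude_mul]
  have e : (fun x => component u j x * component u i x)
      = fun x => component u i x * component u j x := funext fun x => mul_comm _ _
  rw [e]
  have : (2 : ℝ) ^ (Q + 1) ≠ 0 := by positivity
  field_simp
  ring

theorem waveMomentum_testFreq (i j : Fin n) (Q : ℕ) (u : Torus n → Vec n) :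
    waveMomentum (testAmplitude i j Q) (testFreq i j Q) u = torusVolume n *
      ((2 ^ (Q + 1))⁻¹ * (coeff (component u i) (testFreq i j Q)).im
        - (coeff (component u j) (testFreq i j Q)).im) := by
  rw [waveMomentum, sum_testAmplitude_mul]
  ring

/-- For the lower bound, `b ≥ 3θx/16` and `L - L⁻¹ ≥ 3L/4` give `9Lθx/64`, while `a` and `c` take
away at most `θx/8 ≤ 4Lθx/64`. -/
theorem le_stress_of_abs_le {a b c x θ κ L : ℝ} (hx : 0 ≤ x) (hθ : 0 ≤ θ) (hL : 2 ≤ L)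
    (hκ : κ ≤ θ / 16) (ha : |a| ≤ κ * x) (hb : |b - θ * x / 4| ≤ κ * x) (hc : |c| ≤ κ * x) :
    L * (θ * x) / 16 ≤ -a + c + (L - L⁻¹) * b ∧
      -a + c + (L - L⁻¹) * b ≤ 2 * (κ * x) + L * (θ * x / 4 + κ * x) := by
  rw [abs_le] at ha hb hc
  have hLinv0 : 0 ≤ L⁻¹ := by positivity
  have hLinv : L⁻¹ ≤ 1 / 2 := by
    rw [one_div]; exact inv_anti₀ two_pos hL
  have hκx : κ * x ≤ θ * x / 16 := by nlinarith
  have hθx : 0 ≤ θ * x := by positivity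
  have hb0 : 3 * (θ * x) / 16 ≤ b := by linarith
  constructor
  · have h1 : 3 * L / 4 ≤ L - L⁻¹ := by linarith
    have h2 : 3 * L / 4 * (3 * (θ * x) / 16) ≤ (L - L⁻¹) * b :=
      mul_le_mul h1 hb0 (by positivity) (by linarith)
    have h3 : 2 * (θ * x) ≤ L * (θ * x) := mul_le_mul_of_nonneg_right hL hθx
    linarith
  · have h2 : (L - L⁻¹) * b ≤ L * (θ * x / 4 + κ * x) :=
      mul_le_mul (by linarith) (by linarith) (by linarith) (by linarith)
    linarith

/-- A polynomial in `A` without constant term. After division by `θ^Q` the main term is `θ/4`, so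
the perturbation is at most a quarter of it. -/
theorem exists_perturbationSize_le (n : ℕ) (ρ : ℝ) {θ : ℝ} (hθ : 0 < θ) :
    ∃ A, 0 < A ∧ perturbationSize n ρ θ A ≤ θ / 16 := by
  have hc : Continuous (perturbationSize n ρ θ) := by
    unfold perturbationSize
    fun_prop
  have h0 : perturbationSize n ρ θ 0 = 0 := by simp [perturbationSize]
  have h1 : ∀ᶠ A in 𝓝[>] (0 : ℝ), perturbationSize n ρ θ A < θ / 16 :=
    (hc.tendsto 0).mono_left nhdsWithin_le_nhds |>.eventually_lt_const (by rw [h0]; positivity)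
  obtain ⟨A, hA, hA0⟩ := (h1.and self_mem_nhdsWithin).exists
  exact ⟨A, hA0, hA.le⟩

/-- The momentum is linear with amplitudes at most `1`, so it inherits `θ^Q` with no factor `2^Q`,
unlike the stress. -/
theorem IsCutoff.abs_waveMomentum_sub_le (hχ : IsCutoff χ) {ρ A θ : ℝ} (hA : 0 ≤ A) (h0 : 0 ≤ θ)
    (hθ : θ < 1) (h1 : 1 ≤ ρ) {i j : Fin n} (hij : i ≠ j) (Q : ℕ) {u v : Torus n → Vec n}
    (hu : MemLp u 2) (hv : MemLp v 2)
    (hb : ∀ l, BlockBound χ ρ A θ (component (fun x => u x - v x) l)) :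
    |waveMomentum (testAmplitude i j Q) (testFreq i j Q) u
        - waveMomentum (testAmplitude i j Q) (testFreq i j Q) v|
      ≤ torusVolume n * (2 * (A * (θ ^ Q / (1 - θ)))) := by
  have hV := torusVolume_pos n
  set k := testFreq i j Q
  have hw : MemLp (fun x => u x - v x) 2 := hu.sub hv
  have hk : (2 : ℝ) ^ Q ≤ ‖latticeVec k‖ :=
    (pow_le_pow_right₀ (by norm_num) Q.le_succ).trans (le_norm_testFreq hij Q)
  have hd : ∀ l, |(coeff (component u l) k).im - (coeff (component v l) k).im|
      ≤ A * (θ ^ Q / (1 - θ)) := fun l => by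
    have e : coeff (component (fun x => u x - v x) l) k
        = coeff (component u l) k - coeff (component v l) k := by
      rw [← coeff_sub (integrable_of_memLp_two (memLp_component hu l))
        (integrable_of_memLp_two (memLp_component hv l))]
      congr 1
      funext x
      simp [component]
    rw [← Complex.sub_im, ← e]
    exact (Complex.abs_im_le_norm _).trans (hχ.norm_coeff_le_of_blockBound
      (integrable_of_memLp_two (memLp_component hw l)) (hb l) hA h0 hθ h1 hk)
  have hL : ((2 : ℝ) ^ (Q + 1))⁻¹ ≤ 1 := inv_le_one_of_one_le₀ (one_le_pow₀ (by norm_num))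
  have hL0 : 0 ≤ ((2 : ℝ) ^ (Q + 1))⁻¹ := by positivity
  rw [waveMomentum_testFreq, waveMomentum_testFreq, ← mul_sub, abs_mul, abs_of_pos hV]
  refine mul_le_mul_of_nonneg_left ?_ hV.le
  calc _ = |(2 ^ (Q + 1))⁻¹ * ((coeff (component u i) k).im - (coeff (component v i) k).im)
        - ((coeff (component u j) k).im - (coeff (component v j) k).im)| := by
        congr 1; ring
    _ ≤ (2 ^ (Q + 1))⁻¹ * |(coeff (component u i) k).im - (coeff (component v i) k).im|
        + |(coeff (component u j) k).im - (coeff (component v j) k).im| := by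
        refine (abs_sub _ _).trans_eq ?_
        rw [abs_mul, abs_of_nonneg hL0]
    _ ≤ 1 * (A * (θ ^ Q / (1 - θ))) + A * (θ ^ Q / (1 - θ)) := by
        gcongr
        · exact hd i
        · exact hd j
    _ = _ := by ring

theorem exists_bump {τ : ℝ} (hτ : 0 < τ) :
    ∃ η : ℝ → ℝ, ContDiff ℝ ∞ η ∧ (∀ t, 0 ≤ η t) ∧
      (∀ t, t ∉ Set.Icc (τ / 4) (3 * τ / 4) → η t = 0) ∧ 0 < ∫ t, η t := by
  let B : ContDiffBump (τ / 2) := ⟨τ / 8, τ / 4, by positivity, by linarith⟩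
  refine ⟨B, B.contDiff, fun t => B.nonneg, fun t ht => ?_, B.integral_pos⟩
  refine B.zero_of_le_dist ?_
  change τ / 4 ≤ dist t (τ / 2)
  rw [Real.dist_eq]
  by_contra! h
  rw [abs_lt] at h
  exact ht ⟨by linarith, by linarith⟩

/-- A weak solution does not stay close to the initial field on any time interval `(0, τ)`. -/
theorem IsCutoff.not_blockBound (hχ : IsCutoff χ) (hn : 2 ≤ n) {s ρ A : ℝ}
    (hA : 0 ≤ A) (hθ : (2 : ℝ) ^ (-s) < 1) (h1 : 1 ≤ ρ) (h2 : ρ ≤ 2)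
    (hγ : bernsteinConst n ρ * (2 : ℝ) ^ (-s) < 1)
    (hsmall : perturbationSize n ρ (2 ^ (-s)) A ≤ 2 ^ (-s) / 16)
    {T τ : ℝ} (hτ : 0 < τ) (hτT : τ ≤ T) {u : ℝ → L2Field n} (hu : IsWeakSolution T u) :
    ¬ ∀ t ∈ Set.Ioo 0 τ, ∀ l, BlockBound χ ρ A ((2 : ℝ) ^ (-s))
      (component (fun x => u t x - initialField hn s x) l) := by
  intro hb
  set i : Fin n := ⟨0, by omega⟩ with hi
  set j : Fin n := ⟨1, by omega⟩ with hj
  set θ : ℝ := (2 : ℝ) ^ (-s) with hθdef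
  have hij : i ≠ j := by simp [hi, hj]
  have h0 : 0 < θ := by positivity
  have hV := torusVolume_pos n
  have hT : 0 < T := hτ.trans_le hτT
  obtain ⟨η, hη, hη0, hsupp, hηpos⟩ := exists_bump hτ
  have hcont : ∀ g : L2Field n, ContinuousOn (fun t => inner ℝ g (u t)) (Set.Ioo 0 T) := fun g =>
    (hu.weaklyContinuous g).mono Set.Ioo_subset_Ico_self
  have hmem : ∀ t, MemLp (u t : Torus n → Vec n) 2 := fun t => Lp.memLp (u t)
  have hsub : ∀ t ∈ Set.Icc (τ / 4) (3 * τ / 4), t ∈ Set.Ioo 0 τ := fun t ht =>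
    ⟨by linarith [ht.1], by linarith [ht.2]⟩
  have hηT : ∫ t in Set.Ioo 0 T, η t = ∫ t, η t :=
    setIntegral_eq_integral_of_forall_compl_eq_zero fun t ht => hsupp t fun h =>
      ht ⟨(hsub t h).1, (hsub t h).2.trans_le hτT⟩
  -- The bump `η` is fixed before `Q`: the left side grows like `(2θ)^Q`, the right side like `θ^Q`.
  -- The reference constant for the momentum is that of the initial field.
  have key : ∀ Q : ℕ, torusVolume n * (2 ^ (Q + 1) * (θ * θ ^ Q) / 16) * ∫ t, η t
      ≤ torusVolume n * (2 * (A * (θ ^ Q / (1 - θ)))) * ∫ t in Set.Ioo 0 T, |deriv η t| := by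
    intro Q
    rw [← hηT]
    have heq := hu.equation _ (isTestField_planeWave hη (sum_testFreq_mul_testAmplitude hij Q)
      (T := T) (b := τ / 4) (c := 3 * τ / 4) (by positivity) (by linarith) hsupp)
    simp only [integral_planeWave (hη.differentiable (by simp)) _ _ (hmem _)] at heq
    have hstress : ∀ t ∈ Set.Icc (τ / 4) (3 * τ / 4),
        torusVolume n * (2 ^ (Q + 1) * (θ * θ ^ Q) / 16)
          ≤ waveStress (testAmplitude i j Q) (testFreq i j Q) (u t) ∧
        waveStress (testAmplitude i j Q) (testFreq i j Q) (u t)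
          ≤ torusVolume n * (2 * (perturbationSize n ρ θ A * θ ^ Q)
            + 2 ^ (Q + 1) * (θ * θ ^ Q / 4 + perturbationSize n ρ θ A * θ ^ Q)) := fun t ht => by
      have h3 := hχ.norm_coeff_component_mul_le hn hA hθ h1 h2 hγ Q (hmem t) (hb t (hsub t ht))
      have h4 := le_stress_of_abs_le (L := 2 ^ (Q + 1))
        (b := (coeff (fun x => component (u t) i x * component (u t) j x) (testFreq i j Q)).re)
        (pow_nonneg h0.le Q) h0.le (le_self_pow₀ one_le_two (by omega)) hsmall
        ((Complex.abs_re_le_norm _).trans h3.1) (by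
          refine le_trans (le_of_eq ?_) ((Complex.abs_re_le_norm _).trans h3.2.1)
          rw [Complex.sub_re, Complex.ofReal_re, pow_succ, mul_comm θ])
        ((Complex.abs_re_le_norm _).trans h3.2.2)
      rw [waveStress_testFreq]
      exact ⟨mul_le_mul_of_nonneg_left h4.1 hV.le, mul_le_mul_of_nonneg_left h4.2 hV.le⟩
    refine mul_integral_le_of_integral_eq_zero hT (by positivity) (by linarith) hη hη0 hsupp
      ?_ ?_ heq
      (f := waveMomentum (testAmplitude i j Q) (testFreq i j Q) (initialField hn s))
      (fun t ht => hχ.abs_waveMomentum_sub_le hA h0.le hθ h1 hij Q (hmem t)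
        (memLp_initialField hn hθ) (hb t (hsub t ht)))
      (fun t ht => (hstress t ht).1) (fun t ht => (hstress t ht).2)
    · refine ContinuousOn.aestronglyMeasurable ?_ measurableSet_Ioo
      have h3 := fun m => Complex.continuous_im.comp_continuousOn
        (continuousOn_coeff hcont m (testFreq i j Q))
      exact (continuousOn_const.mul
        (continuousOn_finsetSum _ fun m _ => continuousOn_const.mul (h3 m))).neg
    · have h3 := fun l m => Complex.continuous_re.comp_aestronglyMeasurable
        (hχ.aestronglyMeasurable_coeff_mul measurableSet_Ioo hcont l m (testFreq i j Q))
      refine AEStronglyMeasurable.const_mul ?_ _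
      refine Finset.aestronglyMeasurable_fun_sum _ fun l _ => AEStronglyMeasurable.const_mul ?_ _
      exact Finset.aestronglyMeasurable_fun_sum _ fun m _ => (h3 l m).const_mul _
  set I := ∫ t, η t
  set J := ∫ t in Set.Ioo 0 T, |deriv η t|
  have hθ0 : 0 < 1 - θ := by linarith
  have hbound : ∀ Q : ℕ, (2 : ℝ) ^ Q ≤ 16 * A * J / ((1 - θ) * θ * I) := fun Q => by
    rw [le_div_iff₀ (by positivity)]
    have hc : 0 < torusVolume n * θ ^ Q / (8 * (1 - θ)) := by positivity
    refine le_of_mul_le_mul_left ?_ hc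
    calc _ = torusVolume n * (2 ^ (Q + 1) * (θ * θ ^ Q) / 16) * I := by
          field_simp; ring
      _ ≤ _ := key Q
      _ = _ := by field_simp; ring
  obtain ⟨Q, hQ⟩ := pow_unbounded_of_one_lt (16 * A * J / ((1 - θ) * θ * I)) (one_lt_two (α := ℝ))
  exact (hbound Q).not_gt hQ

/-- The product is `2^(n(2/ρ-1) - s)` with `ρ = min r 2`. For `r > 2` the loss disappears and `s >
0` suffices. -/
theorem bernsteinConst_mul_lt_one {r : ℝ≥0∞} {s : ℝ}
    (hs₁ : 2 < r → 0 < s) (hs₂ : r ≤ 2 → (n : ℝ) * (2 / r.toReal - 1) < s) :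
    bernsteinConst n (min r 2).toReal * (2 : ℝ) ^ (-s) < 1 := by
  have hs : (n : ℝ) * (2 / (min r 2).toReal - 1) < s := by
    rcases le_or_gt r 2 with h | h
    · rw [min_eq_left h]; exact hs₂ h
    · rw [min_eq_right h.le]; simpa using hs₁ h
  rw [bernsteinConst, ← Real.rpow_natCast, ← Real.rpow_mul two_pos.le, ← Real.rpow_add two_pos]
  exact Real.rpow_lt_one_of_one_lt_of_neg one_lt_two (by linarith)

end PeriodicEuler

end

/-! ### Discontinuity at time zero -/

open PeriodicEuler
theorem proposition1 {n : ℕ} (hn : 2 ≤ n) (χ : Vec n → ℝ) (hχ : IsCutoff χ)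
    (r : ℝ≥0∞) (hr : 1 ≤ r) (s : ℝ)
    (hs₁ : 2 < r → 0 < s) (hs₂ : r ≤ 2 → (n : ℝ) * (2 / r.toReal - 1) < s) :
    ∃ δ : ℝ, 0 < δ ∧
      ∀ (T : ℝ) (u : ℝ → L2Field n), 0 < T → IsWeakSolution T u →
        (u 0 : Torus n → Vec n) =ᵐ[volume] initialField hn s →
        ENNReal.ofReal δ ≤
          limsup (fun t : ℝ => besovNorm χ s r (fun x => u t x - initialField hn s x))
            (𝓝[>] (0 : ℝ)) := by
  have hfin : min r 2 ≠ ⊤ := ne_top_of_le_ne_top (by simp) (min_le_right r 2)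
  have h1 : 1 ≤ (min r 2).toReal := by
    rw [← ENNReal.toReal_one]; exact ENNReal.toReal_mono hfin (le_min hr one_le_two)
  have h2 : (min r 2).toReal ≤ 2 := by
    simpa using ENNReal.toReal_mono (by simp) (min_le_right r 2)
  have hγ := bernsteinConst_mul_lt_one (n := n) hs₁ hs₂
  have h0 : (0 : ℝ) < 2 ^ (-s) := by positivity
  have hθ : (2 : ℝ) ^ (-s) < 1 :=
    (le_mul_of_one_le_left h0.le (one_le_bernsteinConst h1 h2)).trans_lt hγ
  obtain ⟨A, hA, hsmall⟩ := exists_perturbationSize_le n (min r 2).toReal h0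
  have hV := torusVolume_pos n
  have hc : 0 < torusVolume n * 2 ^ s := by positivity
  -- This `δ` makes the constant `torusVolume n * 2 ^ s * δ` of the block bounds equal to `A`.
  refine ⟨A / (torusVolume n * 2 ^ s), by positivity, fun T u hT hu _ => ?_⟩
  by_contra! hlt
  -- A strict inequality for the upper limit gives closeness at every time of some interval `(0,
  -- ε)`.
  have hev := eventually_lt_of_limsup_lt hlt
  obtain ⟨ε, hε, hεb⟩ := mem_nhdsGT_iff_exists_Ioo_subset.1 hev
  have hε0 : 0 < ε := hε
  refine hχ.not_blockBound hn hA.le hθ h1 h2 hγ hsmall (lt_min hε0 hT) (min_le_right ε T) hu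
    fun t ht l => ?_
  have hbes : besovNorm χ s r (fun x => u t x - initialField hn s x)
      < ENNReal.ofReal (A / (torusVolume n * 2 ^ s)) :=
    hεb ⟨ht.1, ht.2.trans_le (min_le_left ε T)⟩
  have h := hχ.blockBound_of_besovNorm_le hr (by positivity) hbes.le l
  rwa [mul_div_cancel₀ _ hc.ne'] at h
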